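/- Let $1<p<\alpha<2$ and $0<d<1-\frac1\alpha$. Let $\{L_\alpha(t)\}_{t\in\mathbb R}$ be a symmetric $\alpha$-stable process with Lebesgue control measure on a probability space $(\Omega,\mathcal F,\mathbb P)$, that is, $L_\alpha(0)=0$ a.s., $L_\alpha$ has independent increments, and $\mathbb E\,e^{i\theta(L_\alpha(t)-L_\alpha(s))}=e^{-(t-s)|\theta|^\alpha}$ for $s\le t$ and $\theta\in\mathbb R$. A simple function is a function $\phi=\sum_{i=1}^{n-1}a_i\mathbf 1_{(t_i,t_{i+1}]}$ with $a_i\in\mathbb R$ and $t_1<\dots<t_n$; its integral against a process $X$ is $\int\phi\,dX=\sum_{i=1}^{n-1}a_i\,[X(t_{i+1})-X(t_i)]$. For $f\in L^\alpha(\mathbb R)$, the stable integral $\int f\,dL_\alpha$ is the limit in probability of $\int\phi_n\,dL_\alpha$ for any simple functions $\phi_n\to f$ in $L^\alpha(\mathbb R)$. Let $$M_d(t)=\frac1{\Gamma(d+1)}\int_{\mathbb R}\left[(t-x)_+^d-(-x)_+^d\right]dL_\alpha(x),\qquad t\in\mathbb R,$$ be the linear fractional stable motion. For $g\in L^1(\mathbb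 R)\cap L^\alpha(\mathbb R)$ put $$(I_-^dg)(x)=\frac1{\Gamma(d)}\int_x^\infty g(t)(t-x)^{d-1}\,dt,\qquad \|g\|_{\alpha,p}=\left(\mathbb E|L_\alpha(1)|^p\right)^{1/p}\|I_-^dg\|_{L^\alpha(\mathbb R)},$$ and let $\int_{\mathbb R} g\,dM_d$ be the limit in $L^p(\Omega)$ of $\int\phi_n\,dM_d$ for any simple functions $\phi_n$ with $\|\phi_n-g\|_{\alpha,p}\to0$. Let $g_n$ ($n\in\mathbb N$) and $g$ be functions in $L^1(\mathbb R)\cap L^\alpha(\mathbb R)$ such that $g_n\to g$ both in $L^1(\mathbb R)$ and in $L^\alpha(\mathbb R)$. Then the stable integrals defining $M_d(t)$, $t\in\mathbb R$, and the integrals $\int_{\mathbb R} g_n\,dM_d$ and $\int_{\mathbb R} g\,dM_d$ are well defined (approximating simple functions exist, and the limit exists and does not depend on their choice), and $$\int_{\mathbb R} g_n\,dM_d\longrightarrow\int_{\mathbb R} g\,dM_d\quad\text{in }L^p(\Omega)\text{ as }n\to\infty.$$ -/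

import Mathlib

open MeasureTheory ProbabilityTheory Filter Topology

noncomputable section

namespace StableLFSM

/-- `L` is a two-sided symmetric `α`-stable Lévy motion, i.e. an `SαS` process with Lebesgue control
measure: `L 0 = 0` almost surely, the increments over successive intervals are independent, and the
increment over `(s, t]` has the law `S_α((t - s)^{1/α}, 0, 0)`, whose characteristic function is
`θ ↦ exp (-(t - s) |θ|^α)`. -/
structure IsStableLevyMotion {Ω : Type*} [MeasurableSpace Ω] (P : Measure Ω) (α : ℝ)
    (L : ℝ → Ω → ℝ) : Prop where
  measurable : ∀ t, Measurable (L t)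
  zero : L 0 =ᵐ[P] 0
  indep : HasIndepIncrements L P
  charFun_increment : ∀ s t : ℝ, s ≤ t → ∀ θ : ℝ,
    charFun (P.map (L t - L s)) θ = Complex.exp (-(((t - s) * |θ| ^ α : ℝ) : ℂ))

/-- A simple function `∑ i, a i • 1_{(t i, t (i + 1)]}` with nodes `t 0 < t 1 < ⋯ < t n`. -/
structure StepFunction where
  n : ℕ
  t : Fin (n + 1) → ℝ
  strictMono : StrictMono t
  a : Fin n → ℝ

/-- The function on the line which a simple function represents. -/
def StepFunction.toFun (φ : StepFunction) (x : ℝ) : ℝ :=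
  ∑ i : Fin φ.n, (Set.Ioc (φ.t i.castSucc) (φ.t i.succ)).indicator (fun _ => φ.a i) x

/-- The integral `∑ i, a i (X (t (i + 1)) - X (t i))` of a simple function against a process. -/
def StepFunction.integral {Ω : Type*} (φ : StepFunction) (X : ℝ → Ω → ℝ) (ω : Ω) : ℝ :=
  ∑ i : Fin φ.n, φ.a i * (X (φ.t i.succ) ω - X (φ.t i.castSucc) ω)

/-- `X` is (a version of) the stable stochastic integral `∫ f dL`: there are simple functions that
converge to `f` in `L^α(ℝ)`, and for every such sequence the integrals against `L` converge to `X`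
in probability. -/
def IsStableIntegral {Ω : Type*} [MeasurableSpace Ω] (P : Measure Ω) (α : ℝ)
    (L : ℝ → Ω → ℝ) (f : ℝ → ℝ) (X : Ω → ℝ) : Prop :=
  AEMeasurable X P ∧
  (∃ φ : ℕ → StepFunction,
    Tendsto (fun n => eLpNorm (fun x => (φ n).toFun x - f x) (ENNReal.ofReal α) volume)
      atTop (𝓝 0)) ∧
  ∀ φ : ℕ → StepFunction,
    Tendsto (fun n => eLpNorm (fun x => (φ n).toFun x - f x) (ENNReal.ofReal α) volume)
      atTop (𝓝 0) →
    TendstoInMeasure P (fun n => (φ n).integral L) atTop X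

open Classical in
/-- A version of the stable stochastic integral `∫ f dL` (it is unique up to null sets). The value
is the dummy `0` if the integral does not exist. -/
def stableIntegral {Ω : Type*} [MeasurableSpace Ω] (P : Measure Ω) (α : ℝ)
    (L : ℝ → Ω → ℝ) (f : ℝ → ℝ) : Ω → ℝ :=
  if h : ∃ X : Ω → ℝ, IsStableIntegral P α L f X then h.choose else 0

/-- The kernel `x ↦ ((t - x)_+^d - (-x)_+^d) / Γ(d + 1)` of the linear fractional stable motion. -/
def lfsmKernel (d t x : ℝ) : ℝ :=
  (1 / Real.Gamma (d + 1)) * ((max (t - x) 0) ^ d - (max (-x) 0) ^ d)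

/-- `M` is the linear fractional stable motion driven by `L`: for each `t`, almost surely
`M t = ∫ ((t - x)_+^d - (-x)_+^d) / Γ(d + 1) dL(x)`. -/
def IsLFSM {Ω : Type*} [MeasurableSpace Ω] (P : Measure Ω) (α d : ℝ)
    (L M : ℝ → Ω → ℝ) : Prop :=
  ∀ t, M t =ᵐ[P] stableIntegral P α L (lfsmKernel d t)

/-- The right-sided Riemann-Liouville fractional integral of order `d`,
`(I_-^d f)(x) = Γ(d)⁻¹ ∫_x^∞ f(t) (t - x)^{d - 1} dt`. -/
def rlRight (d : ℝ) (f : ℝ → ℝ) (x : ℝ) : ℝ :=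
  (1 / Real.Gamma d) * ∫ t in Set.Ioi x, f t * (t - x) ^ (d - 1)

/-- The norm `‖g‖_{α,p} = (𝔼 |L(1)|^p)^{1/p} * ‖I_-^d g‖_{L^α(ℝ)}`. -/
def normAP {Ω : Type*} [MeasurableSpace Ω] (P : Measure Ω) (α p d : ℝ)
    (L : ℝ → Ω → ℝ) (g : ℝ → ℝ) : ENNReal :=
  eLpNorm (L 1) (ENNReal.ofReal p) P * eLpNorm (rlRight d g) (ENNReal.ofReal α) volume

/-- `X` is (a version of) the integral `∫ g dM` against the linear fractional stable motion `M`: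
there are simple functions that converge to `g` in the norm `‖·‖_{α,p}`, and for every such sequence
the integrals against `M` converge to `X` in `L^p(Ω)`. -/
def IsLFSMIntegral {Ω : Type*} [MeasurableSpace Ω] (P : Measure Ω) (α p d : ℝ)
    (L M : ℝ → Ω → ℝ) (g : ℝ → ℝ) (X : Ω → ℝ) : Prop :=
  MemLp X (ENNReal.ofReal p) P ∧
  (∃ φ : ℕ → StepFunction,
    Tendsto (fun n => normAP P α p d L (fun x => (φ n).toFun x - g x)) atTop (𝓝 0)) ∧
  ∀ φ : ℕ → StepFunction,
    Tendsto (fun n => normAP P α p d L (fun x => (φ n).toFun x - g x)) atTop (𝓝 0) →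
    Tendsto (fun n => eLpNorm (fun ω => (φ n).integral M ω - X ω) (ENNReal.ofReal p) P)
      atTop (𝓝 0)

open Classical in
/-- A version of the integral `∫ g dM` (it is unique up to null sets). The value is the dummy `0` if
the integral does not exist. -/
def lfsmIntegral {Ω : Type*} [MeasurableSpace Ω] (P : Measure Ω) (α p d : ℝ)
    (L M : ℝ → Ω → ℝ) (g : ℝ → ℝ) : Ω → ℝ :=
  if h : ∃ X : Ω → ℝ, IsLFSMIntegral P α p d L M g X then h.choose else 0

end StableLFSM

end

/-! The theorem combines an isometry for stable integrals with a boundedness property of $I_-^d$.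

Characteristic functions of independent increments multiply, so for simple $\phi$ the variable
$\int\phi\,dL$ has the law of $\|\phi\|_\alpha L(1)$ (`map_integral`). Hence its $L^p(\Omega)$ norm
is $\|L(1)\|_p\|\phi\|_\alpha$, where $\|L(1)\|_p<\infty$ because $p<\alpha$ (`memLp_one`). By
density of simple functions the integral extends to all of $L^\alpha(\mathbb R)$, and the upper
bound survives the limit (`HasStableIntegral.eLpNorm_sub_le`).

The kernel $s_+^{d-1}$ is integrable near $0$ since $d>0$, and lies in $L^\alpha$ near infinity
since $d<1-1/\alpha$. Young's inequality on each piece gives $\|I_-^dg\|_\alpha\le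
C(\|g\|_\alpha+\|g\|_1)$ (`exists_eLpNorm_rlRight_le`).

The two are linked by `rlRight_toFun`: $I_-^d\mathbf 1_{(a,b]}$ is the increment from $a$ to $b$ of
the kernel of $M_d$, so $\int\phi\,dM_d=\int I_-^d\phi\,dL$ for simple $\phi$. Therefore $\int
g\,dM_d=\int I_-^dg\,dL$ on $L^1\cap L^\alpha$, and the distance between $\int g_n\,dM_d$ and $\int
g\,dM_d$ is at most $C\|L(1)\|_p(\|g_n-g\|_\alpha+\|g_n-g\|_1)$. -/

namespace StableLFSM

/-! ### Algebra and norms of simple functions -/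

namespace StepFunction

/-- The increment sum `∑ i, a i (F (t (i + 1)) - F (t i))` of a deterministic function. -/
def incr (φ : StepFunction) (F : ℝ → ℝ) : ℝ :=
  ∑ i : Fin φ.n, φ.a i * (F (φ.t i.succ) - F (φ.t i.castSucc))

lemma integral_eq_incr {Ω : Type*} (φ : StepFunction) (X : ℝ → Ω → ℝ) (ω : Ω) :
    φ.integral X ω = φ.incr (fun t => X t ω) := rfl

/-- With `toFun` and `integral` both cast as increment sums, one identity valid for all `F`
transfers to the function and to its integral at once. -/
lemma toFun_eq_incr (φ : StepFunction) (x : ℝ) :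
    φ.toFun x = φ.incr (fun t => if x ≤ t then 1 else 0) := by
  unfold toFun incr
  refine Finset.sum_congr rfl fun i _ => ?_
  have h : φ.t i.castSucc < φ.t i.succ := φ.strictMono Fin.castSucc_lt_succ
  by_cases h1 : x ≤ φ.t i.castSucc
  · have h2 : x ≤ φ.t i.succ := h1.trans h.le
    simp [Set.indicator, h1, h2, not_lt.mpr h1]
  · by_cases h2 : x ≤ φ.t i.succ <;> simp [Set.indicator, h1, h2, not_le.mp h1]

/-- Telescoping. The point is that the coefficients do not depend on `F`. -/
lemma exists_incr_eq_sub_zero {m : ℕ} (s : Fin (m + 1) → ℝ) (k : Fin (m + 1)) :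
    ∃ b : Fin m → ℝ, ∀ F : ℝ → ℝ,
      ∑ i, b i * (F (s i.succ) - F (s i.castSucc)) = F (s k) - F (s 0) := by
  induction k using Fin.induction with
  | zero => exact ⟨0, by simp⟩
  | succ k ih =>
    obtain ⟨b, hb⟩ := ih
    refine ⟨b + Pi.single k 1, fun F => ?_⟩
    have h : ∑ i, (Pi.single k (1 : ℝ) : Fin m → ℝ) i * (F (s i.succ) - F (s i.castSucc))
        = F (s k.succ) - F (s k.castSucc) := by
      rw [Finset.sum_eq_single k] <;> simp +contextual
    simp only [Pi.add_apply, add_mul, Finset.sum_add_distrib, hb, h]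
    ring

lemma exists_refinement (φ : StepFunction) {m : ℕ} (s : Fin (m + 1) → ℝ)
    (h : ∀ i, φ.t i ∈ Set.range s) :
    ∃ b : Fin m → ℝ, ∀ F : ℝ → ℝ,
      ∑ i, b i * (F (s i.succ) - F (s i.castSucc)) = φ.incr F := by
  choose k hk using h
  choose b hb using exists_incr_eq_sub_zero s
  refine ⟨fun i => ∑ l, φ.a l * (b (k l.succ) i - b (k l.castSucc) i), fun F => ?_⟩
  simp only [Finset.sum_mul]
  rw [Finset.sum_comm]
  refine Finset.sum_congr rfl fun l _ => ?_
  have h1 := hb (k l.succ) F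
  have h2 := hb (k l.castSucc) F
  rw [hk] at h1 h2
  calc _ = φ.a l * (∑ i, b (k l.succ) i * (F (s i.succ) - F (s i.castSucc))
        - ∑ i, b (k l.castSucc) i * (F (s i.succ) - F (s i.castSucc))) := by
        rw [← Finset.sum_sub_distrib, Finset.mul_sum]
        exact Finset.sum_congr rfl fun i _ => by ring
    _ = _ := by rw [h1, h2]; ring

/-- Simple functions are closed under linear combinations, compatibly with all increment sums. -/
lemma exists_incr_sub_mul (φ ψ : StepFunction) (c : ℝ) :
    ∃ χ : StepFunction, ∀ F, χ.incr F = φ.incr F - c * ψ.incr F := by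
  classical
  let S : Finset ℝ := Finset.univ.image φ.t ∪ Finset.univ.image ψ.t
  have hS : S.card ≠ 0 :=
    Finset.card_ne_zero_of_mem
      (Finset.mem_union_left _ (Finset.mem_image_of_mem φ.t (Finset.mem_univ 0)))
  obtain ⟨m, hm⟩ := Nat.exists_eq_succ_of_ne_zero hS
  let s := S.orderEmbOfFin hm
  have hr : Set.range s = S := S.range_orderEmbOfFin hm
  obtain ⟨b, hb⟩ := φ.exists_refinement s (fun i => by rw [hr]; simp [S])
  obtain ⟨b', hb'⟩ := ψ.exists_refinement s (fun i => by rw [hr]; simp [S])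
  refine ⟨⟨m, s, s.strictMono, b - c • b'⟩, fun F => ?_⟩
  rw [← hb, ← hb', Finset.mul_sum, ← Finset.sum_sub_distrib]
  exact Finset.sum_congr rfl fun i _ => by simp only [Pi.sub_apply, Pi.smul_apply, smul_eq_mul]; ring

lemma measurable_toFun (φ : StepFunction) : Measurable φ.toFun :=
  Finset.measurable_fun_sum _ fun _ _ => measurable_const.indicator measurableSet_Ioc

lemma eq_of_mem_Ioc (φ : StepFunction) {x : ℝ} {i j : Fin φ.n}
    (hi : x ∈ Set.Ioc (φ.t i.castSucc) (φ.t i.succ))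
    (hj : x ∈ Set.Ioc (φ.t j.castSucc) (φ.t j.succ)) : i = j := by
  have key : ∀ {k l : Fin φ.n}, k < l → φ.t k.succ ≤ φ.t l.castSucc := fun {k l} h =>
    φ.strictMono.monotone (Fin.le_def.mpr (by
      have := Fin.lt_def.mp h
      simp only [Fin.val_succ, Fin.val_castSucc]
      omega))
  rcases lt_trichotomy i j with h | h | h
  · linarith [key h, hi.2, hj.1]
  · exact h
  · linarith [key h, hj.2, hi.1]

lemma toFun_eq_of_mem (φ : StepFunction) {x : ℝ} {i : Fin φ.n}
    (hx : x ∈ Set.Ioc (φ.t i.castSucc) (φ.t i.succ)) : φ.toFun x = φ.a i := by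
  unfold toFun
  rw [Finset.sum_eq_single i, Set.indicator_of_mem hx]
  · exact fun j _ hj => Set.indicator_of_notMem (fun hx' => hj (φ.eq_of_mem_Ioc hx' hx)) _
  · simp

lemma toFun_eq_zero (φ : StepFunction) {x : ℝ}
    (hx : ∀ i : Fin φ.n, x ∉ Set.Ioc (φ.t i.castSucc) (φ.t i.succ)) : φ.toFun x = 0 :=
  Finset.sum_eq_zero fun i _ => Set.indicator_of_notMem (hx i) _

/-- The quantity `∑ i, |a i|^α (t (i + 1) - t i)`, the `α`-th power of the `L^α` norm. -/
noncomputable def energy (φ : StepFunction) (α : ℝ) : ℝ :=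
  ∑ i : Fin φ.n, |φ.a i| ^ α * (φ.t i.succ - φ.t i.castSucc)

lemma node_lt (φ : StepFunction) (i : Fin φ.n) : φ.t i.castSucc < φ.t i.succ :=
  φ.strictMono Fin.castSucc_lt_succ

lemma energy_nonneg (φ : StepFunction) (α : ℝ) : 0 ≤ φ.energy α :=
  Finset.sum_nonneg fun i _ =>
    mul_nonneg (Real.rpow_nonneg (abs_nonneg _) _) (sub_nonneg.mpr (φ.node_lt i).le)

/-- The intervals are disjoint, so at each point at most one term is nonzero and the power passes
inside the sum. -/
lemma eLpNorm_toFun (φ : StepFunction) {α : ℝ} (hα : 0 < α) :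
    eLpNorm φ.toFun (ENNReal.ofReal α) volume = ENNReal.ofReal (φ.energy α ^ (1 / α)) := by
  rw [eLpNorm_eq_lintegral_rpow_enorm_toReal (by simpa using hα) ENNReal.ofReal_ne_top,
    ENNReal.toReal_ofReal hα.le, ← ENNReal.ofReal_rpow_of_nonneg (φ.energy_nonneg α) (by positivity)]
  congr 1
  have h : ∀ x, ‖φ.toFun x‖ₑ ^ α = ∑ i : Fin φ.n,
      (Set.Ioc (φ.t i.castSucc) (φ.t i.succ)).indicator
        (fun _ => ENNReal.ofReal (|φ.a i| ^ α)) x := by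
    intro x
    by_cases hx : ∃ i : Fin φ.n, x ∈ Set.Ioc (φ.t i.castSucc) (φ.t i.succ)
    · obtain ⟨i, hi⟩ := hx
      rw [φ.toFun_eq_of_mem hi, Finset.sum_eq_single i, Set.indicator_of_mem hi,
        ← ENNReal.ofReal_rpow_of_nonneg (abs_nonneg _) hα.le, Real.enorm_eq_ofReal_abs]
      · exact fun j _ hj => Set.indicator_of_notMem (fun hx' => hj (φ.eq_of_mem_Ioc hx' hi)) _
      · simp
    · push Not at hx
      rw [φ.toFun_eq_zero hx, Finset.sum_eq_zero fun i _ => Set.indicator_of_notMem (hx i) _]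
      simp [hα]
  simp_rw [h]
  rw [lintegral_finsetSum _ fun i _ => measurable_const.indicator measurableSet_Ioc, energy,
    ENNReal.ofReal_sum_of_nonneg fun i _ =>
    mul_nonneg (Real.rpow_nonneg (abs_nonneg _) _) (sub_nonneg.mpr (φ.node_lt i).le)]
  refine Finset.sum_congr rfl fun i _ => ?_
  rw [lintegral_indicator_const measurableSet_Ioc, Real.volume_Ioc,
    ENNReal.ofReal_mul (Real.rpow_nonneg (abs_nonneg _) _)]

lemma memLp_toFun (φ : StepFunction) {α : ℝ} (hα : 0 < α) :
    MemLp φ.toFun (ENNReal.ofReal α) volume :=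
  ⟨φ.measurable_toFun.aestronglyMeasurable, by rw [φ.eLpNorm_toFun hα]; exact ENNReal.ofReal_lt_top⟩

end StepFunction

end StableLFSM

/-! ### Laws and moments of integrals of simple functions against the Lévy motion -/

namespace StableLFSM

namespace IsStableLevyMotion

variable {Ω : Type*} [MeasurableSpace Ω] {P : Measure Ω} {α p : ℝ}
  {L : ℝ → Ω → ℝ}

lemma measurable_integral (hL : IsStableLevyMotion P α L) (φ : StepFunction) :
    Measurable (φ.integral L) :=
  Finset.measurable_fun_sum _ fun _ _ =>
    ((hL.measurable _).sub (hL.measurable _)).const_mul _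

lemma charFun_one (hL : IsStableLevyMotion P α L) (θ : ℝ) :
    charFun (P.map (L 1)) θ = Complex.exp (-((|θ| ^ α : ℝ) : ℂ)) := by
  have h := hL.charFun_increment 0 1 zero_le_one θ
  have h0 : (L 1 - L 0) =ᵐ[P] L 1 := by
    filter_upwards [hL.zero] with ω hω
    simp [hω]
  rw [Measure.map_congr h0] at h
  simpa using h

lemma charFun_integral (hL : IsStableLevyMotion P α L) (φ : StepFunction) (θ : ℝ) :
    charFun (P.map (φ.integral L)) θ = Complex.exp (-((φ.energy α * |θ| ^ α : ℝ) : ℂ)) := by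
  have hind := (hL.indep φ.n φ.t φ.strictMono.monotone).comp (fun i x => φ.a i * x)
    (fun i => measurable_const.mul measurable_id)
  have hm : ∀ s t, Measurable (fun ω => L t ω - L s ω) :=
    fun s t => (hL.measurable t).sub (hL.measurable s)
  have h := congrFun (hind.charFun_map_fun_sum_eq_prod
    (fun i => ((hm _ _).const_mul (φ.a i)).aemeasurable)) θ
  change charFun (P.map (φ.integral L)) θ = _ at h
  rw [h, Finset.prod_apply]
  have h2 : ∀ i : Fin φ.n, charFun (P.map (fun ω =>
      φ.a i * (L (φ.t i.succ) ω - L (φ.t i.castSucc) ω))) θ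
      = Complex.exp (-((|φ.a i| ^ α * (φ.t i.succ - φ.t i.castSucc) * |θ| ^ α : ℝ) : ℂ)) := by
    intro i
    have h3 := charFun_map_mul_comp (μ := P) (hm (φ.t i.castSucc) (φ.t i.succ)).aemeasurable
      (φ.a i) θ
    have h4 := hL.charFun_increment _ _ (φ.node_lt i).le (φ.a i * θ)
    refine h3.trans (h4.trans ?_)
    rw [abs_mul, Real.mul_rpow (abs_nonneg _) (abs_nonneg _)]
    congr 3
    ring
  rw [Finset.prod_congr rfl fun i _ => h2 i, ← Complex.exp_sum]
  congr 1
  rw [StepFunction.energy, Finset.sum_mul]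
  push_cast
  rw [Finset.sum_neg_distrib]

variable [IsProbabilityMeasure P]

/-- The integral of a simple function has the law of `L 1` scaled by the `L^α` norm. -/
lemma map_integral (hL : IsStableLevyMotion P α L) (hα : 0 < α) (φ : StepFunction) :
    P.map (φ.integral L) = P.map (fun ω => φ.energy α ^ (1 / α) * L 1 ω) := by
  have := Measure.isProbabilityMeasure_map (μ := P) (hL.measurable_integral φ).aemeasurable
  have := Measure.isProbabilityMeasure_map (μ := P)
    ((hL.measurable 1).const_mul (φ.energy α ^ (1 / α))).aemeasurable
  refine Measure.ext_of_charFun (funext fun θ => ?_)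
  rw [hL.charFun_integral, charFun_map_mul_comp (hL.measurable 1).aemeasurable, hL.charFun_one,
    abs_mul, Real.mul_rpow (abs_nonneg _) (abs_nonneg _),
    abs_of_nonneg (Real.rpow_nonneg (φ.energy_nonneg α) _), ← Real.rpow_mul (φ.energy_nonneg α),
    one_div_mul_cancel hα.ne', Real.rpow_one]

/-- The isometry behind every later estimate. It needs only equality of laws, hence no condition on
`q`. -/
lemma eLpNorm_integral (hL : IsStableLevyMotion P α L) (hα : 0 < α) (φ : StepFunction)
    (q : ENNReal) :
    eLpNorm (φ.integral L) q P
      = eLpNorm (L 1) q P * eLpNorm φ.toFun (ENNReal.ofReal α) volume := by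
  have h1 := eLpNorm_map_measure (μ := P) (p := q) (g := id) (f := φ.integral L)
    measurable_id.aestronglyMeasurable (hL.measurable_integral φ).aemeasurable
  have h2 := eLpNorm_map_measure (μ := P) (p := q) (g := id)
    (f := fun ω => φ.energy α ^ (1 / α) * L 1 ω)
    measurable_id.aestronglyMeasurable
    ((hL.measurable 1).const_mul _).aemeasurable
  rw [hL.map_integral hα] at h1
  rw [← Function.id_comp (φ.integral L), ← h1, h2, Function.id_comp]
  have h3 : (fun ω => φ.energy α ^ (1 / α) * L 1 ω) = (φ.energy α ^ (1 / α)) • L 1 := rfl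
  rw [h3, eLpNorm_const_smul, φ.eLpNorm_toFun hα, mul_comm, Real.enorm_eq_ofReal_abs,
    abs_of_nonneg (Real.rpow_nonneg (φ.energy_nonneg α) _)]

/-- Otherwise the characteristic function of `L 1` at $1$ would be $1$ instead of $e^{-1}$. -/
lemma eLpNorm_one_ne_zero (hL : IsStableLevyMotion P α L) {q : ENNReal} (hq : q ≠ 0) :
    eLpNorm (L 1) q P ≠ 0 := by
  intro h
  rw [eLpNorm_eq_zero_iff (hL.measurable 1).aestronglyMeasurable hq] at h
  have h1 := hL.charFun_one 1
  rw [Measure.map_congr h] at h1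
  have h2 : P.map (0 : Ω → ℝ) = Measure.dirac 0 := by
    have := Measure.map_const P (0 : ℝ)
    rwa [measure_univ, one_smul] at this
  rw [h2, charFun_dirac] at h1
  simp only [inner_zero_left, Complex.ofReal_zero, zero_mul, Complex.exp_zero, abs_one,
    Real.one_rpow, Complex.ofReal_one] at h1
  have h3 : Real.exp (-1) = 1 := by
    apply Complex.ofReal_injective
    push_cast
    exact h1.symm
  simp at h3

/-- A tail is controlled by the characteristic function $\varphi$ near $0$: $P(|X|>r)\le\frac
r2\left|\int_{-2/r}^{2/r}(1-\varphi)\right|$. Here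
$1-\varphi(t)=1-e^{-|t|^\alpha}\le|t|^\alpha\le(2/r)^\alpha$ on an interval of length $4/r$, which
yields the constant. -/
lemma tail_le (hL : IsStableLevyMotion P α L) (hα : 0 < α) {r : ℝ} (hr : 0 < r) :
    P {ω | r < |L 1 ω|} ≤ ENNReal.ofReal (2 * 2 ^ α * r ^ (-α)) := by
  have := Measure.isProbabilityMeasure_map (μ := P) (hL.measurable 1).aemeasurable
  have h := measureReal_abs_gt_le_integral_charFun (μ := P.map (L 1)) hr
  have hset : MeasurableSet {x : ℝ | r < |x|} := measurableSet_lt measurable_const measurable_abs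
  rw [map_measureReal_apply (hL.measurable 1) hset] at h
  have hb : ‖∫ t in (-2 * r⁻¹)..(2 * r⁻¹), 1 - charFun (P.map (L 1)) t‖
      ≤ (2 * r⁻¹) ^ α * |2 * r⁻¹ - (-2 * r⁻¹)| := by
    refine intervalIntegral.norm_integral_le_of_norm_le_const fun t ht => ?_
    have hr' : 0 < r⁻¹ := inv_pos.mpr hr
    rw [Set.uIoc_of_le (by linarith)] at ht
    rw [hL.charFun_one]
    have h1 : (1 : ℂ) - Complex.exp (-((|t| ^ α : ℝ) : ℂ))
        = ((1 - Real.exp (-(|t| ^ α)) : ℝ) : ℂ) := by push_cast; rfl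
    rw [h1, Complex.norm_real, Real.norm_eq_abs]
    have h2 : 0 ≤ |t| ^ α := by positivity
    have h3 := Real.add_one_le_exp (-(|t| ^ α))
    have h4 : Real.exp (-(|t| ^ α)) ≤ 1 := Real.exp_le_one_iff.mpr (by linarith)
    rw [abs_of_nonneg (by linarith)]
    have h5 : |t| ^ α ≤ (2 * r⁻¹) ^ α :=
      Real.rpow_le_rpow (abs_nonneg _) (abs_le.mpr ⟨by linarith [ht.1], ht.2⟩) hα.le
    linarith
  have h6 : P.real {ω | r < |L 1 ω|} ≤ 2 * 2 ^ α * r ^ (-α) := by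
    refine h.trans ((mul_le_mul_of_nonneg_left hb (by positivity)).trans (le_of_eq ?_))
    have h7 : 2 * r⁻¹ - (-2 * r⁻¹) = 4 * r⁻¹ := by ring
    rw [h7, abs_of_pos (by positivity), Real.mul_rpow (by norm_num) (by positivity),
      Real.inv_rpow hr.le, ← Real.rpow_neg hr.le]
    field_simp
    norm_num
  rw [← ofReal_measureReal]
  exact ENNReal.ofReal_le_ofReal h6

/-- A symmetric `α`-stable variable has finite absolute moments of every order below `α`. -/
lemma memLp_one (hL : IsStableLevyMotion P α L) (hp : 0 < p) (hpα : p < α) :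
    MemLp (L 1) (ENNReal.ofReal p) P := by
  refine ⟨(hL.measurable 1).aestronglyMeasurable, ?_⟩
  rw [eLpNorm_lt_top_iff_lintegral_rpow_enorm_lt_top (by simpa using hp) ENNReal.ofReal_ne_top,
    ENNReal.toReal_ofReal hp.le]
  have h0 : ∀ ω, ‖L 1 ω‖ₑ ^ p = ENNReal.ofReal (|L 1 ω| ^ p) := fun ω => by
    rw [Real.enorm_eq_ofReal_abs, ENNReal.ofReal_rpow_of_nonneg (abs_nonneg _) hp.le]
  simp_rw [h0]
  -- Layer-cake formula, split at $t=1$: below, the probability is at most $1$ and $t^{p-1}$ is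
  -- integrable; above, the tail bound leaves $t^{p-1-\alpha}$, integrable since $p<\alpha$.
  rw [lintegral_rpow_eq_lintegral_meas_lt_mul P (ae_of_all _ fun ω => abs_nonneg _)
    (hL.measurable 1).abs.aemeasurable hp]
  refine ENNReal.mul_lt_top ENNReal.ofReal_lt_top ?_
  rw [← Set.Ioc_union_Ioi_eq_Ioi (zero_le_one' ℝ),
    lintegral_union measurableSet_Ioi (Set.Ioc_disjoint_Ioi le_rfl)]
  refine ENNReal.add_lt_top.mpr ⟨?_, ?_⟩
  · have hi : IntegrableOn (fun t : ℝ => t ^ (p - 1)) (Set.Ioc 0 1) :=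
      (intervalIntegrable_iff_integrableOn_Ioc_of_le zero_le_one).mp
        (intervalIntegral.intervalIntegrable_rpow' (by linarith))
    refine lt_of_le_of_lt (lintegral_mono fun t => ?_) hi.lintegral_lt_top
    exact (mul_le_mul_left prob_le_one _).trans (one_mul _).le
  · have hi : IntegrableOn (fun t : ℝ => 2 * 2 ^ α * t ^ (p - 1 - α)) (Set.Ioi 1) :=
      (integrableOn_Ioi_rpow_of_lt (by linarith) one_pos).const_mul _
    refine lt_of_le_of_lt (setLIntegral_mono' measurableSet_Ioi fun t ht => ?_) hi.lintegral_lt_top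
    have ht0 : (0 : ℝ) < t := one_pos.trans ht
    refine (mul_le_mul_left (hL.tail_le (hp.trans hpα) ht0) _).trans (le_of_eq ?_)
    rw [← ENNReal.ofReal_mul (by positivity), mul_assoc, ← Real.rpow_add ht0]
    congr 3
    ring

end IsStableLevyMotion

end StableLFSM

/-! ### Density of simple functions, in $L^q$ and $L^1$ simultaneously -/

namespace StableLFSM

/-- Outside the support of a compactly supported approximant `h`, `f` equals `f - h`, which is
small. -/
lemma exists_eLpNorm_indicator_compl_Ioc_le {f : ℝ → ℝ} {q : ENNReal} (hq : q ≠ ⊤)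
    (hf : MemLp f q volume) {ε : ENNReal} (hε : ε ≠ 0) :
    ∃ R : ℝ, 0 < R ∧ ∀ N, R ≤ N → eLpNorm ((Set.Ioc (-N) N)ᶜ.indicator f) q volume ≤ ε := by
  obtain ⟨h, hc, hle, -, -⟩ := hf.exists_hasCompactSupport_eLpNorm_sub_le hq hε
  obtain ⟨R, hR⟩ := hc.isCompact.isBounded.subset_closedBall 0
  refine ⟨max R 0 + 1, by positivity, fun N hN => ?_⟩
  have hRN : R < N := by linarith [le_max_left R 0]
  have h0 : (Set.Ioc (-N) N)ᶜ.indicator f = (Set.Ioc (-N) N)ᶜ.indicator (f - h) := by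
    funext x
    by_cases hx : x ∈ (Set.Ioc (-N) N)ᶜ
    · have : h x = 0 := by
        by_contra hne
        have := hR (subset_tsupport h hne)
        rw [Metric.mem_closedBall, Real.dist_eq, sub_zero, abs_le] at this
        exact hx ⟨by linarith, by linarith⟩
      simp [Set.indicator_of_mem hx, this]
    · simp [Set.indicator_of_notMem hx]
  rw [h0]
  exact (eLpNorm_indicator_le _).trans hle

lemma StepFunction.exists_uniform_approx {h : ℝ → ℝ} (hu : UniformContinuous h) {N : ℝ} (hN : 0 < N)
    {η : ℝ} (hη : 0 < η) :
    ∃ φ : StepFunction, (∀ x, x ∉ Set.Ioc (-N) N → φ.toFun x = 0) ∧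
      ∀ x ∈ Set.Ioc (-N) N, |φ.toFun x - h x| ≤ η := by
  obtain ⟨δ, hδ, hδh⟩ := Metric.uniformContinuous_iff.mp hu η hη
  obtain ⟨k, hk⟩ := exists_nat_gt (2 * N / δ)
  have hk0 : (0 : ℝ) < k := lt_of_le_of_lt (by positivity) hk
  set w : ℝ := 2 * N / k with hw
  have hw0 : 0 < w := by positivity
  have hwδ : w < δ := by rw [hw, div_lt_iff₀ hk0]; rwa [div_lt_iff₀ hδ, mul_comm (k : ℝ)] at hk
  have hkw : k * w = 2 * N := by rw [hw]; field_simp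
  let φ : StepFunction :=
    { n := k
      t := fun i => -N + w * i
      strictMono := fun i j hij => by
        have : (i : ℝ) < j := by exact_mod_cast hij
        have := mul_lt_mul_of_pos_left this hw0
        simpa using this
      a := fun i => h (-N + w * (i + 1)) }
  refine ⟨φ, fun x hx => φ.toFun_eq_zero fun i hi => hx ?_, fun x hx => ?_⟩
  · have h1 : (0 : ℝ) ≤ w * (i : ℕ) := by positivity
    have h2 : w * ((i : ℕ) + 1 : ℝ) ≤ k * w := by
      rw [mul_comm]
      exact mul_le_mul_of_nonneg_right (by exact_mod_cast i.2) hw0.le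
    have h3 : -N + w * (i : ℕ) < x := by simpa [φ] using hi.1
    have h4 : x ≤ -N + w * ((i : ℕ) + 1 : ℝ) := by simpa [φ] using hi.2
    exact ⟨by linarith, by linarith⟩
  · set y := (x + N) / w with hy
    have hy0 : 0 < y := div_pos (by linarith [hx.1]) hw0
    have hyk : y ≤ k := by rw [hy, div_le_iff₀ hw0]; linarith [hx.2]
    have hyx : x = -N + w * y := by rw [hy]; field_simp; ring
    -- The cells are closed on the right, so the ceiling (not the floor) of `y` locates the cell of
    -- `x`; its index `j` is the ceiling minus one.
    have hc0 : 0 < ⌈y⌉₊ := Nat.ceil_pos.mpr hy0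
    have hck : ⌈y⌉₊ ≤ k := Nat.ceil_le.mpr hyk
    obtain ⟨j, hj⟩ := Nat.exists_eq_succ_of_ne_zero hc0.ne'
    have h1 : y ≤ (j : ℝ) + 1 := by
      have := Nat.le_ceil y
      rw [hj] at this
      exact_mod_cast this
    have h2 : (j : ℝ) < y := Nat.lt_ceil.mp (by omega)
    have hmem : x ∈ Set.Ioc (φ.t (Fin.castSucc (⟨j, by omega⟩ : Fin k)))
        (φ.t (Fin.succ (⟨j, by omega⟩ : Fin k))) := by
      constructor
      · have := mul_lt_mul_of_pos_left h2 hw0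
        simp only [φ, Fin.val_castSucc]
        linarith
      · have := mul_le_mul_of_nonneg_left h1 hw0.le
        simp only [φ, Fin.val_succ, Nat.cast_add, Nat.cast_one]
        linarith
    rw [φ.toFun_eq_of_mem hmem]
    have hd : dist (-N + w * ((j : ℝ) + 1)) x < δ := by
      have e : -N + w * ((j : ℝ) + 1) - x = w * (j + 1 - y) := by rw [hyx]; ring
      rw [Real.dist_eq, e, abs_of_nonneg (mul_nonneg hw0.le (by linarith))]
      nlinarith
    have := hδh hd
    rw [Real.dist_eq] at this
    exact this.le

lemma StepFunction.exists_approx_indicator {f : ℝ → ℝ} {q : ENNReal} (hq1 : 1 ≤ q) (hq : q ≠ ⊤)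
    (hf : MemLp f q volume) {N : ℝ} (hN : 0 < N) {ε : ENNReal} (hε : ε ≠ 0) :
    ∃ φ : StepFunction, (∀ x, x ∉ Set.Ioc (-N) N → φ.toFun x = 0) ∧
      eLpNorm (φ.toFun - (Set.Ioc (-N) N).indicator f) q volume ≤ ε := by
  have hε2 : ε / 2 ≠ 0 := by simpa using hε
  obtain ⟨h, hc, hle, hcont, hmem⟩ := hf.exists_hasCompactSupport_eLpNorm_sub_le hq hε2
  have hvol : volume (Set.Ioc (-N) N) ^ q.toReal⁻¹ ≠ ⊤ :=
    ENNReal.rpow_ne_top_of_nonneg (by positivity) (by simp [Real.volume_Ioc])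
  obtain ⟨η, hη, hηle⟩ := ENNReal.exists_nnreal_pos_mul_lt hvol hε2
  obtain ⟨φ, hφ0, hφ⟩ := StepFunction.exists_uniform_approx
    (hc.uniformContinuous_of_continuous hcont) hN (NNReal.coe_pos.mpr hη)
  refine ⟨φ, hφ0, ?_⟩
  have e : φ.toFun - (Set.Ioc (-N) N).indicator f
      = (Set.Ioc (-N) N).indicator (φ.toFun - h) + (Set.Ioc (-N) N).indicator (h - f) := by
    funext x
    by_cases hx : x ∈ Set.Ioc (-N) N
    · simp [Set.indicator_of_mem hx]
    · simp [Set.indicator_of_notMem hx, hφ0 x hx]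
  rw [e]
  refine (eLpNorm_add_le ?_ ?_ hq1).trans ?_
  · exact (φ.measurable_toFun.aestronglyMeasurable.sub hmem.1).indicator measurableSet_Ioc
  · exact (hmem.1.sub hf.1).indicator measurableSet_Ioc
  rw [← ENNReal.add_halves ε]
  refine add_le_add ?_ ?_
  · rw [eLpNorm_indicator_eq_eLpNorm_restrict measurableSet_Ioc]
    refine (eLpNorm_le_of_ae_bound (C := η) ?_).trans ?_
    · exact (ae_restrict_iff' measurableSet_Ioc).mpr (ae_of_all _ fun x hx => hφ x hx)
    · rw [Measure.restrict_apply_univ, ENNReal.ofReal_coe_nnreal, mul_comm]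
      exact hηle.le
  · refine (eLpNorm_indicator_le _).trans ?_
    rwa [eLpNorm_sub_comm]

/-- Simple functions approximate `f ∈ L^q`, simultaneously in `L^1` if `f` is integrable. -/
lemma StepFunction.exists_approx {f : ℝ → ℝ} {q : ENNReal} (hq1 : 1 ≤ q) (hq : q ≠ ⊤)
    (hf : MemLp f q volume) {ε : ENNReal} (hε : ε ≠ 0) :
    ∃ φ : StepFunction, eLpNorm (φ.toFun - f) q volume ≤ ε ∧
      (MemLp f 1 volume → eLpNorm (φ.toFun - f) 1 volume ≤ ε) := by
  have hε2 : ε / 2 ≠ 0 := by simpa using hε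
  obtain ⟨R, hR0, hR⟩ := exists_eLpNorm_indicator_compl_Ioc_le hq hf hε2
  obtain ⟨R', hR'⟩ : ∃ R' : ℝ, ∀ N, R' ≤ N → MemLp f 1 volume →
      eLpNorm ((Set.Ioc (-N) N)ᶜ.indicator f) 1 volume ≤ ε / 2 := by
    by_cases h1 : MemLp f 1 volume
    · obtain ⟨R', -, h⟩ := exists_eLpNorm_indicator_compl_Ioc_le ENNReal.one_ne_top h1 hε2
      exact ⟨R', fun N hN _ => h N hN⟩
    · exact ⟨0, fun _ _ h => absurd h h1⟩
  set N := max R R' with hNdef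
  have hN : 0 < N := hR0.trans_le (le_max_left _ _)
  have hqr : 1 ≤ q.toReal := by
    rw [← ENNReal.toReal_one]
    exact ENNReal.toReal_mono hq hq1
  have hvol : volume (Set.Ioc (-N) N) ^ (1 / (1 : ENNReal).toReal - 1 / q.toReal) ≠ ⊤ := by
    refine ENNReal.rpow_ne_top_of_nonneg ?_ (by simp [Real.volume_Ioc])
    rw [ENNReal.toReal_one, sub_nonneg]
    exact one_div_le_one_div_of_le one_pos hqr
  obtain ⟨η, hη, hηle⟩ := ENNReal.exists_nnreal_pos_mul_lt hvol hε2
  -- The error lives on $(-N,N]$, where Hölder bounds the $L^1$ norm by the $L^q$ norm times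
  -- $(2N)^{1-1/q}$; `η` absorbs that factor, so one simple function serves both norms.
  obtain ⟨φ, hφ0, hφ⟩ := StepFunction.exists_approx_indicator hq1 hq hf hN
    (ε := min (ε / 2) η) (by simp [hε, hη.ne'])
  set u := φ.toFun - (Set.Ioc (-N) N).indicator f with hu
  have hum : AEStronglyMeasurable u volume :=
    φ.measurable_toFun.aestronglyMeasurable.sub (hf.1.indicator measurableSet_Ioc)
  have hu1 : eLpNorm u 1 volume ≤ ε / 2 := by
    have e : u = (Set.Ioc (-N) N).indicator u := by
      funext x
      by_cases hx : x ∈ Set.Ioc (-N) N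
      · simp [Set.indicator_of_mem hx]
      · simp [Set.indicator_of_notMem hx, hφ0 x hx, hu]
    rw [e, eLpNorm_indicator_eq_eLpNorm_restrict measurableSet_Ioc]
    refine (eLpNorm_le_eLpNorm_mul_rpow_measure_univ hq1 hum.restrict).trans ?_
    rw [Measure.restrict_apply_univ]
    exact (mul_le_mul_left ((eLpNorm_restrict_le _ _ _ _).trans
      (hφ.trans (min_le_right _ _))) _).trans hηle.le
  have e : φ.toFun - f = u - (Set.Ioc (-N) N)ᶜ.indicator f := by
    funext x
    by_cases hx : x ∈ Set.Ioc (-N) N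
    · simp [hu, hx]
    · simp [hu, hx]
  have hcm := hf.1.indicator (measurableSet_Ioc (a := -N) (b := N)).compl
  refine ⟨φ, ?_⟩
  rw [e]
  refine ⟨?_, fun h1 => ?_⟩
  · refine (eLpNorm_sub_le hum hcm hq1).trans ?_
    rw [← ENNReal.add_halves ε]
    exact add_le_add (hφ.trans (min_le_left _ _)) (hR N (le_max_left _ _))
  · refine (eLpNorm_sub_le hum hcm le_rfl).trans ?_
    rw [← ENNReal.add_halves ε]
    exact add_le_add hu1 (hR' N (le_max_right _ _) h1)

end StableLFSM

/-! ### Extension of the stable integral to $L^\alpha(\mathbb R)$ -/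

namespace StableLFSM

variable {Ω : Type*} [MeasurableSpace Ω] {P : Measure Ω} {α p : ℝ}
  {L : ℝ → Ω → ℝ} {f g : ℝ → ℝ} {X Y : Ω → ℝ}

/-- `X` is the `L^p(Ω)`-limit of the integrals of some simple functions converging to `f` in
`L^α(ℝ)`. -/
structure HasStableIntegral (P : Measure Ω) (α p : ℝ) (L : ℝ → Ω → ℝ) (f : ℝ → ℝ) (X : Ω → ℝ) :
    Prop where
  memLp_fun : MemLp f (ENNReal.ofReal α) volume
  memLp : MemLp X (ENNReal.ofReal p) P
  exists_seq : ∃ φ : ℕ → StepFunction,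
    Tendsto (fun n => eLpNorm ((φ n).toFun - f) (ENNReal.ofReal α) volume) atTop (𝓝 0) ∧
    Tendsto (fun n => eLpNorm ((φ n).integral L - X) (ENNReal.ofReal p) P) atTop (𝓝 0)

lemma StepFunction.exists_sub_mul {Ω : Type*} (φ ψ : StepFunction) (c : ℝ) :
    ∃ χ : StepFunction, χ.toFun = φ.toFun - c • ψ.toFun ∧
      ∀ X : ℝ → Ω → ℝ, χ.integral X = φ.integral X - c • ψ.integral X := by
  obtain ⟨χ, hχ⟩ := φ.exists_incr_sub_mul ψ c
  refine ⟨χ, funext fun x => ?_, fun X => funext fun ω => ?_⟩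
  · simp only [toFun_eq_incr, hχ, Pi.sub_apply, Pi.smul_apply, smul_eq_mul]
  · simp only [integral_eq_incr, hχ, Pi.sub_apply, Pi.smul_apply, smul_eq_mul]

lemma tendsto_eLpNorm_sub_smul {ι β : Type*} [MeasurableSpace β] {μ : Measure β} {q : ENNReal}
    (hq : 1 ≤ q) {l : Filter ι} {u v : ι → β → ℝ} {u' v' : β → ℝ}
    (hu : ∀ n, AEStronglyMeasurable (u n) μ) (hv : ∀ n, AEStronglyMeasurable (v n) μ)
    (hu' : AEStronglyMeasurable u' μ) (hv' : AEStronglyMeasurable v' μ)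
    (h1 : Tendsto (fun n => eLpNorm (u n - u') q μ) l (𝓝 0))
    (h2 : Tendsto (fun n => eLpNorm (v n - v') q μ) l (𝓝 0)) (c : ℝ) :
    Tendsto (fun n => eLpNorm ((u n - c • v n) - (u' - c • v')) q μ) l (𝓝 0) := by
  have h3 : Tendsto (fun n => eLpNorm (u n - u') q μ + ‖c‖ₑ * eLpNorm (v n - v') q μ) l (𝓝 0) := by
    simpa using h1.add (ENNReal.Tendsto.const_mul h2 (Or.inr enorm_ne_top))
  refine tendsto_of_tendsto_of_tendsto_of_le_of_le tendsto_const_nhds h3 (fun _ => zero_le)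
    fun n => ?_
  have e : (u n - c • v n) - (u' - c • v') = (u n - u') - c • (v n - v') := by
    rw [smul_sub]; abel
  simp only [e]
  refine (eLpNorm_sub_le ((hu n).sub hu') (((hv n).sub hv').const_smul c) hq).trans ?_
  rw [eLpNorm_const_smul]

namespace HasStableIntegral

lemma congr_ae (h : HasStableIntegral P α p L f X) (hXY : X =ᵐ[P] Y) :
    HasStableIntegral P α p L f Y := by
  refine ⟨h.memLp_fun, h.memLp.ae_eq hXY, ?_⟩
  obtain ⟨φ, h1, h2⟩ := h.exists_seq
  refine ⟨φ, h1, h2.congr fun n => eLpNorm_congr_ae ?_⟩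
  filter_upwards [hXY] with ω hω
  simp [hω]

lemma sub_smul (hL : IsStableLevyMotion P α L) (hα : 1 ≤ α) (hp : 1 ≤ p)
    (hf : HasStableIntegral P α p L f X) (hg : HasStableIntegral P α p L g Y) (c : ℝ) :
    HasStableIntegral P α p L (f - c • g) (X - c • Y) := by
  refine ⟨hf.memLp_fun.sub (hg.memLp_fun.const_smul c), hf.memLp.sub (hg.memLp.const_smul c), ?_⟩
  obtain ⟨φ, h1, h2⟩ := hf.exists_seq
  obtain ⟨ψ, h3, h4⟩ := hg.exists_seq
  choose χ hχ hχ' using fun n => StepFunction.exists_sub_mul (Ω := Ω) (φ n) (ψ n) c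
  refine ⟨χ, ?_, ?_⟩
  · simp only [hχ]
    exact tendsto_eLpNorm_sub_smul (by simpa using hα)
      (fun n => (φ n).measurable_toFun.aestronglyMeasurable)
      (fun n => (ψ n).measurable_toFun.aestronglyMeasurable) hf.memLp_fun.1 hg.memLp_fun.1 h1 h3 c
  · simp only [hχ']
    exact tendsto_eLpNorm_sub_smul (by simpa using hp)
      (fun n => (hL.measurable_integral (φ n)).aestronglyMeasurable)
      (fun n => (hL.measurable_integral (ψ n)).aestronglyMeasurable) hf.memLp.1 hg.memLp.1 h2 h4 c

variable [IsProbabilityMeasure P]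

lemma of_stepFunction (hL : IsStableLevyMotion P α L) (hα : 0 < α) (hp : 0 < p) (hpα : p < α)
    (φ : StepFunction) : HasStableIntegral P α p L φ.toFun (φ.integral L) := by
  refine ⟨φ.memLp_toFun hα, ⟨(hL.measurable_integral φ).aestronglyMeasurable, ?_⟩,
    fun _ => φ, by simp, by simp⟩
  rw [hL.eLpNorm_integral hα]
  exact ENNReal.mul_lt_top (hL.memLp_one hp hpα).2 (φ.memLp_toFun hα).2

lemma zero (hL : IsStableLevyMotion P α L) (hα : 1 ≤ α) (hp : 1 ≤ p) (hpα : p < α) :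
    HasStableIntegral P α p L 0 0 := by
  let φ : StepFunction := ⟨0, fun _ => 0, fun i j h => absurd h (by omega), fun _ => 0⟩
  have h := of_stepFunction (p := p) hL (by linarith) (by linarith) hpα φ
  simpa using h.sub_smul hL hα hp h 1

lemma sum_smul (hL : IsStableLevyMotion P α L) (hα : 1 ≤ α) (hp : 1 ≤ p) (hpα : p < α)
    {ι : Type*} (s : Finset ι) (c : ι → ℝ) {F : ι → ℝ → ℝ} {Z : ι → Ω → ℝ}
    (h : ∀ i, HasStableIntegral P α p L (F i) (Z i)) :
    HasStableIntegral P α p L (∑ i ∈ s, c i • F i) (∑ i ∈ s, c i • Z i) := by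
  classical
  induction s using Finset.induction_on with
  | empty => simpa using zero hL hα hp hpα
  | insert i s hi ih =>
    -- Closure is available in the form $X-cY$, so adding a term means subtracting it with
    -- coefficient `-c i`.
    have := ih.sub_smul hL hα hp (h i) (-c i)
    rw [Finset.sum_insert hi, Finset.sum_insert hi, add_comm, add_comm (c i • Z i)]
    simpa using this

/-- The isometry on simple functions passes to the limit. Applied to differences, this inequality
gives uniqueness and convergence along every approximating sequence, although `HasStableIntegral`
asks for one sequence only. -/
lemma eLpNorm_le (hL : IsStableLevyMotion P α L) (hα : 1 ≤ α) (hp : 1 ≤ p) (hpα : p < α)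
    (h : HasStableIntegral P α p L f X) :
    eLpNorm X (ENNReal.ofReal p) P
      ≤ eLpNorm (L 1) (ENNReal.ofReal p) P * eLpNorm f (ENNReal.ofReal α) volume := by
  obtain ⟨φ, h1, h2⟩ := h.exists_seq
  set c := eLpNorm (L 1) (ENNReal.ofReal p) P with hc
  have hctop : c ≠ ⊤ := (hL.memLp_one (by linarith) hpα).2.ne
  have hlim : Tendsto (fun n => eLpNorm ((φ n).integral L - X) (ENNReal.ofReal p) P +
      c * (eLpNorm ((φ n).toFun - f) (ENNReal.ofReal α) volume
        + eLpNorm f (ENNReal.ofReal α) volume)) atTop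
      (𝓝 (0 + c * (0 + eLpNorm f (ENNReal.ofReal α) volume))) :=
    h2.add (ENNReal.Tendsto.const_mul (h1.add_const _) (Or.inr hctop))
  rw [zero_add, zero_add] at hlim
  refine ge_of_tendsto' hlim fun n => ?_
  have hm := (hL.measurable_integral (φ n)).aestronglyMeasurable (μ := P)
  have e : X = (φ n).integral L - ((φ n).integral L - X) := by abel
  have e' : (φ n).toFun = ((φ n).toFun - f) + f := by abel
  calc eLpNorm X (ENNReal.ofReal p) P
      ≤ eLpNorm ((φ n).integral L) (ENNReal.ofReal p) P
        + eLpNorm ((φ n).integral L - X) (ENNReal.ofReal p) P := by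
        conv_lhs => rw [e]
        exact eLpNorm_sub_le hm (hm.sub h.memLp.1) (by simpa using hp)
    _ ≤ _ := by
        rw [hL.eLpNorm_integral (by linarith), add_comm, ← hc]
        gcongr
        conv_lhs => rw [e']
        exact eLpNorm_add_le
          ((φ n).measurable_toFun.aestronglyMeasurable.sub h.memLp_fun.1) h.memLp_fun.1
          (by simpa using hα)

lemma eLpNorm_sub_le (hL : IsStableLevyMotion P α L) (hα : 1 ≤ α) (hp : 1 ≤ p) (hpα : p < α)
    (hf : HasStableIntegral P α p L f X) (hg : HasStableIntegral P α p L g Y) :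
    eLpNorm (X - Y) (ENNReal.ofReal p) P
      ≤ eLpNorm (L 1) (ENNReal.ofReal p) P * eLpNorm (f - g) (ENNReal.ofReal α) volume := by
  have h := (hf.sub_smul hL hα hp hg 1).eLpNorm_le hL hα hp hpα
  rwa [one_smul, one_smul] at h

lemma ae_eq (hL : IsStableLevyMotion P α L) (hα : 1 ≤ α) (hp : 1 ≤ p) (hpα : p < α)
    (h : HasStableIntegral P α p L f X) (h' : HasStableIntegral P α p L f Y) : X =ᵐ[P] Y := by
  have h0 := h.eLpNorm_sub_le hL hα hp hpα h'
  rw [sub_self, eLpNorm_zero, mul_zero, nonpos_iff_eq_zero,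
    eLpNorm_eq_zero_iff (h.memLp.1.sub h'.memLp.1) (by simpa using by linarith)] at h0
  filter_upwards [h0] with ω hω
  exact sub_eq_zero.mp hω

lemma tendsto_integral (hL : IsStableLevyMotion P α L) (hα : 1 ≤ α) (hp : 1 ≤ p) (hpα : p < α)
    (h : HasStableIntegral P α p L f X) {φ : ℕ → StepFunction}
    (hφ : Tendsto (fun n => eLpNorm ((φ n).toFun - f) (ENNReal.ofReal α) volume) atTop (𝓝 0)) :
    Tendsto (fun n => eLpNorm ((φ n).integral L - X) (ENNReal.ofReal p) P) atTop (𝓝 0) := by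
  have hctop : eLpNorm (L 1) (ENNReal.ofReal p) P ≠ ⊤ := (hL.memLp_one (by linarith) hpα).2.ne
  have h3 := ENNReal.Tendsto.const_mul hφ (Or.inr hctop)
  rw [mul_zero] at h3
  exact tendsto_of_tendsto_of_tendsto_of_le_of_le tendsto_const_nhds h3 (fun _ => zero_le)
    fun n => (of_stepFunction hL (by linarith) (by linarith) hpα (φ n)).eLpNorm_sub_le
      hL hα hp hpα h

lemma isStableIntegral (hL : IsStableLevyMotion P α L) (hα : 1 ≤ α) (hp : 1 ≤ p) (hpα : p < α)
    (h : HasStableIntegral P α p L f X) : IsStableIntegral P α L f X := by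
  refine ⟨h.memLp.1.aemeasurable, ?_, fun φ hφ => ?_⟩
  · obtain ⟨φ, h1, -⟩ := h.exists_seq
    exact ⟨φ, h1⟩
  · exact tendstoInMeasure_of_tendsto_eLpNorm (p := ENNReal.ofReal p) (by simpa using by linarith)
      (fun n => (hL.measurable_integral (φ n)).aestronglyMeasurable) h.memLp.1
      (h.tendsto_integral hL hα hp hpα hφ)

/-- Limits in probability are unique, so the arbitrarily chosen version inherits the $L^p$
properties of `X`. -/
lemma stableIntegral_ae_eq (hL : IsStableLevyMotion P α L) (hα : 1 ≤ α) (hp : 1 ≤ p) (hpα : p < α)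
    (h : HasStableIntegral P α p L f X) : stableIntegral P α L f =ᵐ[P] X := by
  have hX := h.isStableIntegral hL hα hp hpα
  have hex : ∃ Y, IsStableIntegral P α L f Y := ⟨X, hX⟩
  have hs : IsStableIntegral P α L f (stableIntegral P α L f) := by
    rw [stableIntegral, dif_pos hex]
    exact hex.choose_spec
  obtain ⟨φ, h1⟩ := hX.2.1
  exact tendstoInMeasure_ae_unique (hs.2.2 φ h1) (hX.2.2 φ h1)

end HasStableIntegral

variable [IsProbabilityMeasure P]

lemma exists_hasStableIntegral (hL : IsStableLevyMotion P α L) (hα : 1 ≤ α) (hp : 1 ≤ p)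
    (hpα : p < α) (hf : MemLp f (ENNReal.ofReal α) volume) :
    ∃ X, HasStableIntegral P α p L f X := by
  have hα1 : (1 : ENNReal) ≤ ENNReal.ofReal α := by simpa using hα
  set c := eLpNorm (L 1) (ENNReal.ofReal p) P with hc
  have hctop : c ≠ ⊤ := (hL.memLp_one (by linarith) hpα).2.ne
  have hc0 : c ≠ 0 := hL.eLpNorm_one_ne_zero (by simpa using by linarith)
  let e : ℕ → ENNReal := fun n => 2⁻¹ ^ n
  have he0 : ∀ n, e n ≠ 0 := fun n => pow_ne_zero _ (by simp)
  have hetop : ∀ n, e n ≠ ⊤ := fun n => ENNReal.pow_ne_top (by simp)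
  have hemono : ∀ N n, N ≤ n → e n ≤ e N := fun N n h =>
    pow_le_pow_right_of_le_one' (by simp) h
  choose φ hφ using fun n => (StepFunction.exists_approx hα1 ENNReal.ofReal_ne_top hf
    (he0 n)).imp fun _ h => h.1
  -- Two approximation errors give at most $2c\,e_N$; the factor $3$ makes the Cauchy bound strict,
  -- using $0<c<\infty$.
  have hsum : ∑' n, (c * 3) * e n ≠ ⊤ := by
    rw [ENNReal.tsum_mul_left, ENNReal.tsum_geometric]
    refine ENNReal.mul_ne_top (ENNReal.mul_ne_top hctop (by simp)) ?_
    rw [ENNReal.one_sub_inv_two]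
    simp
  have hstep := fun n => HasStableIntegral.of_stepFunction (p := p) hL (by linarith) (by linarith)
    hpα (φ n)
  have hm := fun n => (φ n).measurable_toFun.aestronglyMeasurable (μ := volume)
  obtain ⟨X, hX, hlim⟩ := Lp.cauchy_complete_eLpNorm (μ := P) (p := ENNReal.ofReal p)
    (by simpa using hp) (f := fun n => (φ n).integral L) (fun n => (hstep n).memLp) hsum (by
      intro N n m hn hm'
      refine ((hstep n).eLpNorm_sub_le hL hα hp hpα (hstep m)).trans_lt ?_
      have e1 : (φ n).toFun - (φ m).toFun = ((φ n).toFun - f) - ((φ m).toFun - f) := by abel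
      rw [← hc, mul_assoc]
      refine ENNReal.mul_lt_mul_right hc0 hctop ?_
      calc eLpNorm ((φ n).toFun - (φ m).toFun) (ENNReal.ofReal α) volume
          ≤ e n + e m := by
            rw [e1]
            exact (eLpNorm_sub_le ((hm n).sub hf.1) ((hm m).sub hf.1) hα1).trans
              (add_le_add (hφ n) (hφ m))
        _ ≤ e N + e N := add_le_add (hemono _ _ hn) (hemono _ _ hm')
        _ = 2 * e N := (two_mul _).symm
        _ < 3 * e N := ENNReal.mul_lt_mul_left (he0 N) (hetop N) (by norm_num))
  refine ⟨X, hf, hX, φ, ?_, hlim⟩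
  refine tendsto_of_tendsto_of_tendsto_of_le_of_le tendsto_const_nhds
    (ENNReal.tendsto_pow_atTop_nhds_zero_of_lt_one (r := 2⁻¹) (by simp)) (fun _ => zero_le) hφ

end StableLFSM

/-! ### Boundedness of the fractional integral from $L^1\cap L^\alpha$ to $L^\alpha$ -/

namespace StableLFSM

/-- Young's convolution inequality, for nonnegative functions on the line. -/
lemma lintegral_lintegral_mul_add_rpow_le {r : ℝ} (hr : 1 < r) {u v : ℝ → ENNReal}
    (hu : Measurable u) (hv : Measurable v) :
    ∫⁻ x, (∫⁻ y, u y * v (x + y)) ^ r ≤ (∫⁻ y, u y) ^ r * ∫⁻ y, v y ^ r := by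
  have hr0 : 0 < r := by linarith
  set q := r / (r - 1) with hq
  have hrq : r.HolderConjugate q := Real.HolderConjugate.conjExponent hr
  have hexp : 1 / q * r + 1 = r := by
    rw [hq]
    have : r - 1 ≠ 0 := by linarith
    field_simp
    ring
  -- Hölder for $u\,v=(u^{1/r}v)\cdot u^{1/q}$ with $1/r+1/q=1$. Integrating in $x$, Tonelli and
  -- translation invariance then give the inequality.
  have hpt : ∀ x, (∫⁻ y, u y * v (x + y)) ^ r
      ≤ (∫⁻ y, u y) ^ (1 / q * r) * ∫⁻ y, u y * v (x + y) ^ r := by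
    intro x
    have hvx : Measurable fun y => v (x + y) := hv.comp (measurable_const_add x)
    have h := ENNReal.lintegral_mul_le_Lp_mul_Lq volume hrq
      (f := fun y => u y ^ (1 / r) * v (x + y)) (g := fun y => u y ^ (1 / q))
      ((hu.pow_const _).mul hvx).aemeasurable (hu.pow_const _).aemeasurable
    have e1 : ∀ y, ((fun y => u y ^ (1 / r) * v (x + y)) * fun y => u y ^ (1 / q)) y
        = u y * v (x + y) := by
      intro y
      simp only [Pi.mul_apply]
      rw [mul_right_comm, ← ENNReal.rpow_add_of_nonneg _ _ (by positivity)
        (one_div_nonneg.mpr hrq.symm.nonneg), one_div, one_div, hrq.inv_add_inv_eq_one,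
        ENNReal.rpow_one]
    have e2 : ∀ y, (u y ^ (1 / r) * v (x + y)) ^ r = u y * v (x + y) ^ r := by
      intro y
      rw [ENNReal.mul_rpow_of_nonneg _ _ hr0.le, ← ENNReal.rpow_mul, one_div_mul_cancel hr0.ne',
        ENNReal.rpow_one]
    have e3 : ∀ y, (u y ^ (1 / q)) ^ q = u y := by
      intro y
      rw [← ENNReal.rpow_mul, one_div_mul_cancel hrq.symm.pos.ne', ENNReal.rpow_one]
    simp only [e1, e2, e3] at h
    calc _ ≤ _ := ENNReal.rpow_le_rpow h hr0.le
      _ = _ := by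
        rw [ENNReal.mul_rpow_of_nonneg _ _ hr0.le, ← ENNReal.rpow_mul, ← ENNReal.rpow_mul,
          one_div_mul_cancel hr0.ne', ENNReal.rpow_one, mul_comm]
  have hm : Measurable fun z : ℝ × ℝ => u z.2 * v (z.1 + z.2) ^ r :=
    (hu.comp measurable_snd).mul ((hv.comp measurable_add).pow_const r)
  calc ∫⁻ x, (∫⁻ y, u y * v (x + y)) ^ r
      ≤ ∫⁻ x, (∫⁻ y, u y) ^ (1 / q * r) * ∫⁻ y, u y * v (x + y) ^ r := lintegral_mono hpt
    _ = (∫⁻ y, u y) ^ (1 / q * r) * ∫⁻ x, ∫⁻ y, u y * v (x + y) ^ r :=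
        lintegral_const_mul _ hm.lintegral_prod_right
    _ = (∫⁻ y, u y) ^ (1 / q * r) * ∫⁻ y, ∫⁻ x, u y * v (x + y) ^ r := by
        rw [lintegral_lintegral_swap hm.aemeasurable]
    _ = (∫⁻ y, u y) ^ (1 / q * r) * ((∫⁻ y, u y) ^ (1 : ℝ) * ∫⁻ y, v y ^ r) := by
        rw [ENNReal.rpow_one, ← lintegral_mul_const _ hu]
        congr 1
        refine lintegral_congr fun y => ?_
        have hvy : Measurable fun x => v (x + y) ^ r :=
          (hv.comp (measurable_add_const y)).pow_const r
        rw [lintegral_const_mul _ hvy, lintegral_add_right_eq_self (fun x => v x ^ r) y]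
    _ = _ := by
        rw [← mul_assoc, ← ENNReal.rpow_add_of_nonneg _ _ ?_ zero_le_one, hexp]
        have := hrq.symm.pos
        positivity

/-- The one-sided power kernel `s ↦ s_+^{d - 1}`. -/
noncomputable def powKernel (d s : ℝ) : ℝ := (Set.Ioi 0).indicator (fun s => s ^ (d - 1)) s

lemma measurable_powKernel (d : ℝ) : Measurable (powKernel d) :=
  (measurable_id.pow_const _).indicator measurableSet_Ioi

lemma rlRight_eq (d : ℝ) (g : ℝ → ℝ) (x : ℝ) :
    rlRight d g x = (1 / Real.Gamma d) * ∫ t, g t * powKernel d (t - x) := by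
  rw [rlRight, ← integral_indicator measurableSet_Ioi]
  congr 2
  funext t
  by_cases h : t ∈ Set.Ioi x
  · rw [Set.indicator_of_mem h, powKernel, Set.indicator_of_mem (by simpa using h)]
  · rw [Set.indicator_of_notMem h, powKernel, Set.indicator_of_notMem (by simpa using h), mul_zero]

lemma rlRight_congr_ae {d : ℝ} {g h : ℝ → ℝ} (hgh : g =ᵐ[volume] h) :
    rlRight d g = rlRight d h := by
  funext x
  rw [rlRight_eq, rlRight_eq]
  congr 1
  refine integral_congr_ae ?_
  filter_upwards [hgh] with t ht
  rw [ht]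

lemma measurable_rlRight {d : ℝ} {g : ℝ → ℝ} (hg : Measurable g) : Measurable (rlRight d g) := by
  have e : rlRight d g = fun x => (1 / Real.Gamma d) * ∫ t, g t * powKernel d (t - x) :=
    funext (rlRight_eq d g)
  rw [e]
  have hm : Measurable fun z : ℝ × ℝ => g z.2 * powKernel d (z.2 - z.1) :=
    (hg.comp measurable_snd).mul
      ((measurable_powKernel d).comp (measurable_snd.sub measurable_fst))
  exact (hm.stronglyMeasurable.integral_prod_right).measurable.const_mul _

/-- The majorant of the fractional integral, with values in `[0, ∞]`. -/
noncomputable def rlMajorant (d : ℝ) (g : ℝ → ℝ) (x : ℝ) : ENNReal :=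
  ∫⁻ t, ‖g t * powKernel d (t - x)‖ₑ

lemma enorm_rlRight_le (d : ℝ) (g : ℝ → ℝ) (x : ℝ) :
    ‖rlRight d g x‖ₑ ≤ ‖1 / Real.Gamma d‖ₑ * rlMajorant d g x := by
  rw [rlRight_eq, enorm_mul]
  gcongr
  exact enorm_integral_le_lintegral_enorm _

lemma measurable_rlMajorant {d : ℝ} {g : ℝ → ℝ} (hg : Measurable g) :
    Measurable (rlMajorant d g) := by
  have hm : Measurable fun z : ℝ × ℝ => ‖g z.2 * powKernel d (z.2 - z.1)‖ₑ :=
    ((hg.comp measurable_snd).mul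
      ((measurable_powKernel d).comp (measurable_snd.sub measurable_fst))).enorm
  exact hm.lintegral_prod_right

lemma lintegral_powKernel_near_lt_top {d : ℝ} (hd : 0 < d) :
    ∫⁻ s, (Set.Ioc 0 1).indicator (fun s => ‖powKernel d s‖ₑ) s < ⊤ := by
  rw [lintegral_indicator measurableSet_Ioc]
  have hi : IntegrableOn (fun t : ℝ => t ^ (d - 1)) (Set.Ioc 0 1) :=
    (intervalIntegrable_iff_integrableOn_Ioc_of_le zero_le_one).mp
      (intervalIntegral.intervalIntegrable_rpow' (by linarith))
  refine lt_of_le_of_lt (setLIntegral_mono' measurableSet_Ioc fun t ht => ?_) hi.2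
  rw [powKernel, Set.indicator_of_mem (show t ∈ Set.Ioi 0 from ht.1)]

/-- The upper bound on $d$ says exactly that $(d-1)\alpha<-1$. -/
lemma lintegral_powKernel_far_lt_top {α d : ℝ} (hα : 0 < α) (hd : d < 1 - 1 / α) :
    ∫⁻ s, ((Set.Ioi 1).indicator (fun s => ‖powKernel d s‖ₑ) s) ^ α < ⊤ := by
  have hexp : (d - 1) * α < -1 := by
    have h : (d - 1) < -(1 / α) := by linarith
    have := mul_lt_mul_of_pos_right h hα
    rwa [neg_mul, one_div_mul_cancel hα.ne'] at this
  have e : ∀ s, ((Set.Ioi 1).indicator (fun s => ‖powKernel d s‖ₑ) s) ^ α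
      = (Set.Ioi 1).indicator (fun s => ‖powKernel d s‖ₑ ^ α) s := by
    intro s
    by_cases h : s ∈ Set.Ioi (1 : ℝ)
    · simp only [Set.indicator_of_mem h]
    · simp only [Set.indicator_of_notMem h, ENNReal.zero_rpow_of_pos hα]
  simp_rw [e]
  rw [lintegral_indicator measurableSet_Ioi]
  have hi : IntegrableOn (fun t : ℝ => t ^ ((d - 1) * α)) (Set.Ioi 1) :=
    integrableOn_Ioi_rpow_of_lt hexp one_pos
  refine lt_of_le_of_lt (setLIntegral_mono' measurableSet_Ioi fun t ht => ?_) hi.2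
  have ht0 : (0 : ℝ) < t := one_pos.trans ht
  rw [powKernel, Set.indicator_of_mem (show t ∈ Set.Ioi 0 from ht0),
    Real.enorm_of_nonneg (by positivity), Real.enorm_of_nonneg (by positivity),
    ENNReal.ofReal_rpow_of_nonneg (by positivity) hα.le, ← Real.rpow_mul ht0.le]

/-- The fractional integral is dominated in `L^α` by the norms of `L^α` and `L^1`. -/
lemma exists_lintegral_rlMajorant_le {α d : ℝ} (hα : 1 < α) (hd0 : 0 < d) (hd1 : d < 1 - 1 / α) :
    ∃ C : ENNReal, C ≠ ⊤ ∧ ∀ g : ℝ → ℝ, Measurable g →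
      (∫⁻ x, rlMajorant d g x ^ α) ^ (1 / α)
        ≤ C * (eLpNorm g (ENNReal.ofReal α) volume + eLpNorm g 1 volume) := by
  have hα0 : 0 < α := by linarith
  set k₁ : ℝ → ENNReal := (Set.Ioc 0 1).indicator (fun s => ‖powKernel d s‖ₑ) with hk₁
  set k₂ : ℝ → ENNReal := (Set.Ioi 1).indicator (fun s => ‖powKernel d s‖ₑ) with hk₂
  have hm₁ : Measurable k₁ := (measurable_powKernel d).enorm.indicator measurableSet_Ioc
  have hm₂ : Measurable k₂ := (measurable_powKernel d).enorm.indicator measurableSet_Ioi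
  have hk : ∀ s, ‖powKernel d s‖ₑ = k₁ s + k₂ s := by
    intro s
    rcases le_or_gt s 0 with h | h
    · have h1 : ¬ (1 : ℝ) < s := by linarith
      simp [hk₁, hk₂, powKernel, Set.indicator, not_lt.mpr h, h1]
    · rcases le_or_gt s 1 with h1 | h1
      · simp [hk₁, hk₂, h, h1, not_lt.mpr h1]
      · simp [hk₁, hk₂, h1, not_le.mpr h1]
  set C₁ := ∫⁻ s, k₁ s with hC₁
  set C₂ := (∫⁻ s, k₂ s ^ α) ^ (1 / α) with hC₂
  have hC₁top : C₁ ≠ ⊤ := (lintegral_powKernel_near_lt_top hd0).ne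
  have hC₂top : C₂ ≠ ⊤ := ENNReal.rpow_ne_top_of_nonneg (by positivity)
    (lintegral_powKernel_far_lt_top hα0 hd1).ne
  refine ⟨max C₁ C₂, by simp [hC₁top, hC₂top], fun g hg => ?_⟩
  -- In Young's inequality the first factor is measured in $L^1$ and the second in $L^\alpha$. The
  -- near kernel is integrable and plays the first role; for the far kernel, which lies in
  -- $L^\alpha$, the roles are exchanged by the reflection $s\mapsto-s$.
  have hT : ∀ x, rlMajorant d g x
      = (∫⁻ s, k₁ s * ‖g (x + s)‖ₑ) + ∫⁻ s, ‖g (-s)‖ₑ * k₂ (-(x + s)) := by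
    intro x
    have e1 : ∫⁻ s, k₁ s * ‖g (x + s)‖ₑ = ∫⁻ t, k₁ (t - x) * ‖g t‖ₑ := by
      rw [← lintegral_sub_right_eq_self (fun s => k₁ s * ‖g (x + s)‖ₑ) x]
      simp
    have e2 : ∫⁻ s, ‖g (-s)‖ₑ * k₂ (-(x + s)) = ∫⁻ t, ‖g t‖ₑ * k₂ (t - x) := by
      rw [← lintegral_neg_eq_self (fun t => ‖g t‖ₑ * k₂ (t - x))]
      refine lintegral_congr fun s => ?_
      rw [neg_add', neg_sub_comm]
    rw [e1, e2, ← lintegral_add_left, rlMajorant]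
    · refine lintegral_congr fun t => ?_
      rw [enorm_mul, hk]
      ring
    · exact (hm₁.comp (measurable_id.sub_const x)).mul hg.enorm
  have h1m : Measurable fun x => ∫⁻ s, k₁ s * ‖g (x + s)‖ₑ := by
    have : Measurable fun z : ℝ × ℝ => k₁ z.2 * ‖g (z.1 + z.2)‖ₑ :=
      (hm₁.comp measurable_snd).mul (hg.comp measurable_add).enorm
    exact this.lintegral_prod_right
  have h2m : Measurable fun x => ∫⁻ s, ‖g (-s)‖ₑ * k₂ (-(x + s)) := by
    have : Measurable fun z : ℝ × ℝ => ‖g (-z.2)‖ₑ * k₂ (-(z.1 + z.2)) :=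
      (hg.comp measurable_snd.neg).enorm.mul (hm₂.comp measurable_add.neg)
    exact this.lintegral_prod_right
  have hroot : ∀ a b : ENNReal, (a ^ α * b) ^ (1 / α) = a * b ^ (1 / α) := fun a b => by
    rw [ENNReal.mul_rpow_of_nonneg _ _ (by positivity), ← ENNReal.rpow_mul,
      mul_one_div_cancel hα0.ne', ENNReal.rpow_one]
  have hb1 : (∫⁻ x, (∫⁻ s, k₁ s * ‖g (x + s)‖ₑ) ^ α) ^ (1 / α)
      ≤ C₁ * eLpNorm g (ENNReal.ofReal α) volume := by
    have h := lintegral_lintegral_mul_add_rpow_le hα hm₁ (v := fun t => ‖g t‖ₑ) hg.enorm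
    refine (ENNReal.rpow_le_rpow h (by positivity)).trans (le_of_eq ?_)
    rw [hroot, eLpNorm_eq_lintegral_rpow_enorm_toReal (by simpa using hα0) ENNReal.ofReal_ne_top,
      ENNReal.toReal_ofReal hα0.le]
  have hb2 : (∫⁻ x, (∫⁻ s, ‖g (-s)‖ₑ * k₂ (-(x + s))) ^ α) ^ (1 / α)
      ≤ C₂ * eLpNorm g 1 volume := by
    have h := lintegral_lintegral_mul_add_rpow_le hα (u := fun s => ‖g (-s)‖ₑ)
      (v := fun s => k₂ (-s)) (hg.comp measurable_neg).enorm (hm₂.comp measurable_neg)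
    refine (ENNReal.rpow_le_rpow h (by positivity)).trans (le_of_eq ?_)
    rw [hroot, lintegral_neg_eq_self (fun s => ‖g s‖ₑ), lintegral_neg_eq_self (fun s => k₂ s ^ α),
      eLpNorm_one_eq_lintegral_enorm, mul_comm]
  simp_rw [hT]
  refine (ENNReal.lintegral_Lp_add_le h1m.aemeasurable h2m.aemeasurable hα.le).trans ?_
  rw [mul_add]
  exact add_le_add (hb1.trans (mul_le_mul_left (le_max_left _ _) _))
    (hb2.trans (mul_le_mul_left (le_max_right _ _) _))

lemma aestronglyMeasurable_rlRight {d : ℝ} {g : ℝ → ℝ} (hg : AEStronglyMeasurable g volume) :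
    AEStronglyMeasurable (rlRight d g) volume := by
  rw [rlRight_congr_ae hg.aemeasurable.ae_eq_mk]
  exact (measurable_rlRight hg.aemeasurable.measurable_mk).aestronglyMeasurable

lemma exists_eLpNorm_rlRight_le {α d : ℝ} (hα : 1 < α) (hd0 : 0 < d) (hd1 : d < 1 - 1 / α) :
    ∃ C : ENNReal, C ≠ ⊤ ∧ ∀ g : ℝ → ℝ, AEStronglyMeasurable g volume →
      eLpNorm (rlRight d g) (ENNReal.ofReal α) volume
        ≤ C * (eLpNorm g (ENNReal.ofReal α) volume + eLpNorm g 1 volume) := by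
  have hα0 : 0 < α := by linarith
  obtain ⟨C, hC, h⟩ := exists_lintegral_rlMajorant_le hα hd0 hd1
  refine ⟨‖1 / Real.Gamma d‖ₑ * C, ENNReal.mul_ne_top enorm_ne_top hC, fun g hg => ?_⟩
  have hmk := hg.aemeasurable.ae_eq_mk
  rw [rlRight_congr_ae hmk, eLpNorm_congr_ae hmk, eLpNorm_congr_ae (p := 1) hmk]
  have hmeas := hg.aemeasurable.measurable_mk
  set g' := hg.aemeasurable.mk g
  rw [eLpNorm_eq_lintegral_rpow_enorm_toReal (by simpa using hα0) ENNReal.ofReal_ne_top,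
    ENNReal.toReal_ofReal hα0.le, mul_assoc]
  refine le_trans ?_ (mul_le_mul_right (h g' hmeas) _)
  have e : ‖1 / Real.Gamma d‖ₑ * (∫⁻ x, rlMajorant d g' x ^ α) ^ (1 / α)
      = (∫⁻ x, (‖1 / Real.Gamma d‖ₑ * rlMajorant d g' x) ^ α) ^ (1 / α) := by
    simp_rw [ENNReal.mul_rpow_of_nonneg _ _ hα0.le]
    rw [lintegral_const_mul _ ((measurable_rlMajorant hmeas).pow_const α),
      ENNReal.mul_rpow_of_nonneg _ _ (by positivity), ← ENNReal.rpow_mul,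
      mul_one_div_cancel hα0.ne', ENNReal.rpow_one]
  rw [e]
  exact ENNReal.rpow_le_rpow (lintegral_mono fun x =>
    ENNReal.rpow_le_rpow (enorm_rlRight_le d g' x) hα0.le) (by positivity)

lemma memLp_rlRight {α d : ℝ} (hα : 1 < α) (hd0 : 0 < d) (hd1 : d < 1 - 1 / α) {g : ℝ → ℝ}
    (h1 : MemLp g 1 volume) (hgα : MemLp g (ENNReal.ofReal α) volume) :
    MemLp (rlRight d g) (ENNReal.ofReal α) volume := by
  obtain ⟨C, hC, h⟩ := exists_eLpNorm_rlRight_le hα hd0 hd1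
  exact ⟨aestronglyMeasurable_rlRight h1.1, (h g h1.1).trans_lt
    (ENNReal.mul_lt_top hC.lt_top (ENNReal.add_lt_top.mpr ⟨hgα.2, h1.2⟩))⟩

/-- The majorant has finite $L^\alpha$ norm, hence is finite almost everywhere. This rules out the
default value $0$ of the integral and makes `rlRight` additive almost everywhere. -/
lemma ae_integrable_mul_powKernel {α d : ℝ} (hα : 1 < α) (hd0 : 0 < d) (hd1 : d < 1 - 1 / α)
    {g : ℝ → ℝ} (h1 : MemLp g 1 volume) (hgα : MemLp g (ENNReal.ofReal α) volume) :
    ∀ᵐ x, Integrable fun t => g t * powKernel d (t - x) := by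
  have hα0 : 0 < α := by linarith
  obtain ⟨C, hC, h⟩ := exists_lintegral_rlMajorant_le hα hd0 hd1
  have hmk := h1.1.aemeasurable.ae_eq_mk
  have hmeas := h1.1.aemeasurable.measurable_mk
  set g' := h1.1.aemeasurable.mk g
  have hfin : (∫⁻ x, rlMajorant d g' x ^ α) ^ (1 / α) < ⊤ :=
    (h g' hmeas).trans_lt (ENNReal.mul_lt_top hC.lt_top
      (ENNReal.add_lt_top.mpr ⟨(hgα.ae_eq hmk).2, (h1.ae_eq hmk).2⟩))
  have hfin' : ∫⁻ x, rlMajorant d g' x ^ α ≠ ⊤ := by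
    intro htop
    rw [htop, ENNReal.top_rpow_of_pos (by positivity)] at hfin
    exact lt_irrefl _ hfin
  filter_upwards [ae_lt_top ((measurable_rlMajorant hmeas).pow_const α) hfin'] with x hx
  have hx' : rlMajorant d g' x < ⊤ := (ENNReal.rpow_lt_top_iff_of_pos hα0).mp hx
  have hint : Integrable fun t => g' t * powKernel d (t - x) :=
    ⟨(hmeas.mul ((measurable_powKernel d).comp
      (measurable_id.sub_const x))).aestronglyMeasurable, hx'⟩
  refine hint.congr ?_
  filter_upwards [hmk] with t ht
  rw [ht]

lemma rlRight_sub_ae {α d : ℝ} (hα : 1 < α) (hd0 : 0 < d) (hd1 : d < 1 - 1 / α) {g h : ℝ → ℝ}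
    (hg1 : MemLp g 1 volume) (hgα : MemLp g (ENNReal.ofReal α) volume)
    (hh1 : MemLp h 1 volume) (hhα : MemLp h (ENNReal.ofReal α) volume) :
    rlRight d (g - h) =ᵐ[volume] rlRight d g - rlRight d h := by
  filter_upwards [ae_integrable_mul_powKernel hα hd0 hd1 hg1 hgα,
    ae_integrable_mul_powKernel hα hd0 hd1 hh1 hhα] with x hx hx'
  simp only [Pi.sub_apply, rlRight_eq, sub_mul]
  rw [integral_sub hx hx', mul_sub]

end StableLFSM

/-! ### Integration against the linear fractional stable motion -/

namespace StableLFSM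

/-- The maxima treat all positions of `x` relative to `a` and `b` together; the interval is empty
when `x ≥ b`. -/
lemma indicator_mul_powKernel (d a b x c t : ℝ) :
    (Set.Ioc a b).indicator (fun _ => c) t * powKernel d (t - x)
      = (Set.Ioc (max a x) (max b x)).indicator (fun t => c * (t - x) ^ (d - 1)) t := by
  by_cases h2 : x < t
  · rw [powKernel, Set.indicator_of_mem (s := Set.Ioi 0) (by simpa using h2)]
    by_cases h1 : t ∈ Set.Ioc a b
    · have h3 : t ∈ Set.Ioc (max a x) (max b x) :=
        ⟨max_lt_iff.mpr ⟨h1.1, h2⟩, h1.2.trans (le_max_left _ _)⟩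
      rw [Set.indicator_of_mem h1, Set.indicator_of_mem h3]
    · have h3 : t ∉ Set.Ioc (max a x) (max b x) := fun h =>
        h1 ⟨(max_lt_iff.mp h.1).1, (le_max_iff.mp h.2).resolve_right (not_le.mpr h2)⟩
      rw [Set.indicator_of_notMem h1, Set.indicator_of_notMem h3, zero_mul]
  · have h3 : t ∉ Set.Ioc (max a x) (max b x) := fun h => h2 (max_lt_iff.mp h.1).2
    rw [Set.indicator_of_notMem h3, powKernel,
      Set.indicator_of_notMem (s := Set.Ioi 0) (by simpa using h2), mul_zero]

lemma integrable_indicator_mul_powKernel {d : ℝ} (hd : 0 < d) (a b x c : ℝ) :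
    Integrable fun t => (Set.Ioc a b).indicator (fun _ => c) t * powKernel d (t - x) := by
  simp_rw [indicator_mul_powKernel]
  refine (integrable_indicator_iff measurableSet_Ioc).mpr ?_
  have h0 : IntervalIntegrable (fun t : ℝ => t ^ (d - 1)) volume
      (max a x - x) (max b x - x) := intervalIntegral.intervalIntegrable_rpow' (by linarith)
  have h1 := (h0.comp_sub_right x).const_mul c
  simp only [sub_add_cancel] at h1
  exact h1.1

/-- The antiderivative $s^d/d$ and $\Gamma(d+1)=d\,\Gamma(d)$ give $(b-x)_+^d-(a-x)_+^d$; the terms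
$(-x)_+^d$ of the two kernels cancel. -/
lemma integral_indicator_mul_powKernel {d : ℝ} (hd : 0 < d) {a b : ℝ} (hab : a ≤ b) (x c : ℝ) :
    (1 / Real.Gamma d) * ∫ t, (Set.Ioc a b).indicator (fun _ => c) t * powKernel d (t - x)
      = c * (lfsmKernel d b x - lfsmKernel d a x) := by
  have hmax : ∀ y, max y x - x = max (y - x) 0 := fun y => by
    rw [← max_sub_sub_right, sub_self]
  simp_rw [indicator_mul_powKernel]
  rw [integral_indicator measurableSet_Ioc,
    ← intervalIntegral.integral_of_le (max_le_max_right x hab), intervalIntegral.integral_const_mul,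
    intervalIntegral.integral_comp_sub_right (fun t => t ^ (d - 1)) x,
    integral_rpow (Or.inl (by linarith)), hmax, hmax, lfsmKernel, lfsmKernel,
    Real.Gamma_add_one hd.ne', sub_add_cancel]
  have := (Real.Gamma_pos_of_pos hd).ne'
  field_simp
  ring

/-- The fractional integral of a simple function is the integral of the simple function against
the kernel of the linear fractional stable motion. -/
lemma rlRight_toFun {d : ℝ} (hd : 0 < d) (φ : StepFunction) :
    rlRight d φ.toFun = φ.integral (lfsmKernel d) := by
  funext x
  rw [rlRight_eq]
  simp only [StepFunction.toFun, Finset.sum_mul, StepFunction.integral]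
  rw [integral_finsetSum _ fun i _ => integrable_indicator_mul_powKernel hd _ _ x _,
    Finset.mul_sum]
  exact Finset.sum_congr rfl fun i _ =>
    integral_indicator_mul_powKernel hd (φ.node_lt i).le x (φ.a i)

/-- The kernel increment is $I_-^d\mathbf 1_{(a,b]}$, so the bound on $I_-^d$ replaces a direct
estimate at infinity. The kernel itself follows since it vanishes at $t=0$. -/
lemma memLp_lfsmKernel_sub {α d : ℝ} (hα : 1 < α) (hd0 : 0 < d) (hd1 : d < 1 - 1 / α) {a b : ℝ}
    (hab : a < b) :
    MemLp (fun x => lfsmKernel d b x - lfsmKernel d a x) (ENNReal.ofReal α) volume := by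
  let φ : StepFunction :=
    { n := 1
      t := ![a, b]
      strictMono := by
        rw [Fin.strictMono_iff_lt_succ]
        intro i
        fin_cases i
        simpa using hab
      a := fun _ => 1 }
  have h1 : MemLp φ.toFun 1 volume := by simpa using φ.memLp_toFun one_pos
  have h := memLp_rlRight hα hd0 hd1 h1 (φ.memLp_toFun (by linarith))
  rw [rlRight_toFun hd0] at h
  have e : φ.integral (lfsmKernel d) = fun x => lfsmKernel d b x - lfsmKernel d a x := by
    funext x
    simp [StepFunction.integral, φ]
  rwa [e] at h

lemma memLp_lfsmKernel {α d : ℝ} (hα : 1 < α) (hd0 : 0 < d) (hd1 : d < 1 - 1 / α) (t : ℝ) :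
    MemLp (lfsmKernel d t) (ENNReal.ofReal α) volume := by
  have h0 : lfsmKernel d 0 = 0 := by
    funext x
    simp [lfsmKernel]
  rcases lt_trichotomy t 0 with h | h | h
  · have := (memLp_lfsmKernel_sub hα hd0 hd1 h).neg
    rw [h0] at this
    convert this using 1
    funext x
    simp
  · rw [h, h0]
    exact MemLp.zero
  · have := memLp_lfsmKernel_sub hα hd0 hd1 h
    rw [h0] at this
    simpa using this

variable {Ω : Type*} [MeasurableSpace Ω] {P : Measure Ω} {α p d : ℝ}
  {L M : ℝ → Ω → ℝ}

lemma IsLFSMIntegral.ae_eq {g : ℝ → ℝ} {X Y : Ω → ℝ} (hp : 1 ≤ p)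
    (hM : ∀ t, AEStronglyMeasurable (M t) P)
    (hX : IsLFSMIntegral P α p d L M g X) (hY : IsLFSMIntegral P α p d L M g Y) : X =ᵐ[P] Y := by
  obtain ⟨φ, hφ⟩ := hX.2.1
  have hp0 : ENNReal.ofReal p ≠ 0 := by simpa using by linarith
  have hm : ∀ n, AEStronglyMeasurable ((φ n).integral M) P := fun n =>
    Finset.aestronglyMeasurable_fun_sum _ fun i _ => ((hM _).sub (hM _)).const_mul _
  exact tendstoInMeasure_ae_unique
    (tendstoInMeasure_of_tendsto_eLpNorm hp0 hm hX.1.1 (hX.2.2 φ hφ))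
    (tendstoInMeasure_of_tendsto_eLpNorm hp0 hm hY.1.1 (hY.2.2 φ hφ))

variable [IsProbabilityMeasure P]

lemma IsLFSM.hasStableIntegral (hM : IsLFSM P α d L M) (hL : IsStableLevyMotion P α L)
    (hα : 1 < α) (hp : 1 ≤ p) (hpα : p < α) (hd0 : 0 < d) (hd1 : d < 1 - 1 / α) (t : ℝ) :
    HasStableIntegral P α p L (lfsmKernel d t) (M t) := by
  obtain ⟨X, hX⟩ := exists_hasStableIntegral hL hα.le hp hpα (memLp_lfsmKernel hα hd0 hd1 t)
  exact hX.congr_ae ((hM t).trans (hX.stableIntegral_ae_eq hL hα.le hp hpα)).symm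

/-- The integral of a simple function against the linear fractional stable motion is the stable
integral of the fractional integral of the simple function. -/
lemma IsLFSM.hasStableIntegral_integral (hM : IsLFSM P α d L M) (hL : IsStableLevyMotion P α L)
    (hα : 1 < α) (hp : 1 ≤ p) (hpα : p < α) (hd0 : 0 < d) (hd1 : d < 1 - 1 / α)
    (φ : StepFunction) : HasStableIntegral P α p L (rlRight d φ.toFun) (φ.integral M) := by
  have hk := hM.hasStableIntegral hL hα hp hpα hd0 hd1
  have h := HasStableIntegral.sum_smul hL hα.le hp hpα Finset.univ φ.a
    (F := fun i => lfsmKernel d (φ.t i.succ) - (1 : ℝ) • lfsmKernel d (φ.t i.castSucc))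
    (Z := fun i => M (φ.t i.succ) - (1 : ℝ) • M (φ.t i.castSucc))
    (fun i => (hk _).sub_smul hL hα.le hp (hk _) 1)
  rw [rlRight_toFun hd0]
  convert h using 1
  · funext x
    simp [StepFunction.integral]
  · funext ω
    simp [StepFunction.integral]

/-- The bound on $I_-^d$ involves both norms, which is why simultaneous approximation in $L^1$ and
$L^\alpha$ is required. -/
lemma exists_tendsto_normAP {g : ℝ → ℝ} (hL : IsStableLevyMotion P α L)
    (hα : 1 < α) (hp : 1 ≤ p) (hpα : p < α) (hd0 : 0 < d) (hd1 : d < 1 - 1 / α)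
    (h1 : MemLp g 1 volume) (hgα : MemLp g (ENNReal.ofReal α) volume) :
    ∃ φ : ℕ → StepFunction,
      Tendsto (fun n => normAP P α p d L (fun x => (φ n).toFun x - g x)) atTop (𝓝 0) := by
  obtain ⟨C, hC, hle⟩ := exists_eLpNorm_rlRight_le hα hd0 hd1
  have hctop : eLpNorm (L 1) (ENNReal.ofReal p) P ≠ ⊤ := (hL.memLp_one (by linarith) hpα).2.ne
  choose φ hφα hφ1 using fun n : ℕ => StepFunction.exists_approx (by simpa using hα.le)
    ENNReal.ofReal_ne_top hgα (ε := 2⁻¹ ^ n) (pow_ne_zero n (by simp))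
  have h2 : Tendsto (fun n : ℕ => (2⁻¹ : ENNReal) ^ n) atTop (𝓝 0) :=
    ENNReal.tendsto_pow_atTop_nhds_zero_of_lt_one (by simp)
  have hlim : Tendsto (fun n : ℕ => eLpNorm (L 1) (ENNReal.ofReal p) P *
      (C * ((2⁻¹ : ENNReal) ^ n + 2⁻¹ ^ n))) atTop (𝓝 0) := by
    simpa using ENNReal.Tendsto.const_mul (ENNReal.Tendsto.const_mul (h2.add h2) (Or.inr hC))
      (Or.inr hctop)
  refine ⟨φ, tendsto_of_tendsto_of_tendsto_of_le_of_le tendsto_const_nhds hlim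
    (fun _ => zero_le) fun n => mul_le_mul_right ?_ _⟩
  exact (hle _ ((φ n).measurable_toFun.aestronglyMeasurable.sub h1.1)).trans
    (mul_le_mul_right (add_le_add (hφα n) (hφ1 n h1)) _)

/-- For simple $\phi$, $\int\phi\,dM-X$ is the stable integral of $I_-^d\phi-I_-^dg$, so its $L^p$
norm is at most $\|\phi-g\|_{\alpha,p}$. -/
lemma HasStableIntegral.isLFSMIntegral {g : ℝ → ℝ} {X : Ω → ℝ} (hM : IsLFSM P α d L M)
    (hL : IsStableLevyMotion P α L) (hα : 1 < α) (hp : 1 ≤ p) (hpα : p < α) (hd0 : 0 < d)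
    (hd1 : d < 1 - 1 / α) (h1 : MemLp g 1 volume) (hgα : MemLp g (ENNReal.ofReal α) volume)
    (hX : HasStableIntegral P α p L (rlRight d g) X) : IsLFSMIntegral P α p d L M g X := by
  refine ⟨hX.memLp, exists_tendsto_normAP hL hα hp hpα hd0 hd1 h1 hgα, fun φ hφ => ?_⟩
  refine tendsto_of_tendsto_of_tendsto_of_le_of_le tendsto_const_nhds hφ (fun _ => zero_le)
    fun n => ?_
  have hs1 : MemLp (φ n).toFun 1 volume := by simpa using (φ n).memLp_toFun one_pos
  refine ((hM.hasStableIntegral_integral hL hα hp hpα hd0 hd1 (φ n)).eLpNorm_sub_le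
    hL hα.le hp hpα hX).trans (le_of_eq ?_)
  rw [normAP, ← eLpNorm_congr_ae (rlRight_sub_ae hα hd0 hd1 hs1
    ((φ n).memLp_toFun (by linarith)) h1 hgα)]
  rfl

/-- For `g ∈ L^1 ∩ L^α`, the integral `∫ g dM` exists and is the stable integral of the fractional
integral of `g`. -/
lemma lfsmIntegral_spec {g : ℝ → ℝ} (hM : IsLFSM P α d L M)
    (hL : IsStableLevyMotion P α L) (hα : 1 < α) (hp : 1 ≤ p) (hpα : p < α) (hd0 : 0 < d)
    (hd1 : d < 1 - 1 / α) (h1 : MemLp g 1 volume) (hgα : MemLp g (ENNReal.ofReal α) volume) :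
    IsLFSMIntegral P α p d L M g (lfsmIntegral P α p d L M g) ∧
      HasStableIntegral P α p L (rlRight d g) (lfsmIntegral P α p d L M g) := by
  obtain ⟨X, hX⟩ := exists_hasStableIntegral hL hα.le hp hpα (memLp_rlRight hα hd0 hd1 h1 hgα)
  have hX' := hX.isLFSMIntegral hM hL hα hp hpα hd0 hd1 h1 hgα
  have hex : ∃ Y, IsLFSMIntegral P α p d L M g Y := ⟨X, hX'⟩
  have hs : IsLFSMIntegral P α p d L M g (lfsmIntegral P α p d L M g) := by
    rw [lfsmIntegral, dif_pos hex]
    exact hex.choose_spec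
  exact ⟨hs, hX.congr_ae (hX'.ae_eq hp
    (fun t => (hM.hasStableIntegral hL hα hp hpα hd0 hd1 t).memLp.1) hs)⟩

end StableLFSM

theorem theorem3p3 {Ω : Type*} [MeasurableSpace Ω] (P : Measure Ω) [IsProbabilityMeasure P]
    (α p d : ℝ) (hα1 : 1 < α) (hα2 : α < 2) (hp1 : 1 < p) (hpα : p < α)
    (hd0 : 0 < d) (hd1 : d < 1 - 1 / α)
    (L : ℝ → Ω → ℝ) (hL : StableLFSM.IsStableLevyMotion P α L)
    (M : ℝ → Ω → ℝ) (hM : StableLFSM.IsLFSM P α d L M)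
    (g : ℕ → ℝ → ℝ) (g₀ : ℝ → ℝ)
    (hg1 : ∀ n, MemLp (g n) 1 volume) (hgα : ∀ n, MemLp (g n) (ENNReal.ofReal α) volume)
    (hg₀1 : MemLp g₀ 1 volume) (hg₀α : MemLp g₀ (ENNReal.ofReal α) volume)
    (hlim1 : Tendsto (fun n => eLpNorm (g n - g₀) 1 volume) atTop (𝓝 0))
    (hlimα : Tendsto (fun n => eLpNorm (g n - g₀) (ENNReal.ofReal α) volume) atTop (𝓝 0)) :
    (∀ t, StableLFSM.IsStableIntegral P α L (StableLFSM.lfsmKernel d t) (M t)) ∧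
    (∀ n, StableLFSM.IsLFSMIntegral P α p d L M (g n)
      (StableLFSM.lfsmIntegral P α p d L M (g n))) ∧
    StableLFSM.IsLFSMIntegral P α p d L M g₀ (StableLFSM.lfsmIntegral P α p d L M g₀) ∧
    Tendsto (fun n => eLpNorm
      (StableLFSM.lfsmIntegral P α p d L M (g n) - StableLFSM.lfsmIntegral P α p d L M g₀)
      (ENNReal.ofReal p) P) atTop (𝓝 0) := by
  have hspec := fun n => StableLFSM.lfsmIntegral_spec hM hL hα1 hp1.le hpα hd0 hd1 (hg1 n) (hgα n)
  have hspec₀ := StableLFSM.lfsmIntegral_spec hM hL hα1 hp1.le hpα hd0 hd1 hg₀1 hg₀α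
  refine ⟨fun t => (hM.hasStableIntegral hL hα1 hp1.le hpα hd0 hd1 t).isStableIntegral
    hL hα1.le hp1.le hpα, fun n => (hspec n).1, hspec₀.1, ?_⟩
  obtain ⟨C, hC, hle⟩ := StableLFSM.exists_eLpNorm_rlRight_le hα1 hd0 hd1
  have hctop : eLpNorm (L 1) (ENNReal.ofReal p) P ≠ ⊤ := (hL.memLp_one (by linarith) hpα).2.ne
  have hlim : Tendsto (fun n => eLpNorm (L 1) (ENNReal.ofReal p) P *
      (C * (eLpNorm (g n - g₀) (ENNReal.ofReal α) volume + eLpNorm (g n - g₀) 1 volume)))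
      atTop (𝓝 0) := by
    simpa using ENNReal.Tendsto.const_mul (ENNReal.Tendsto.const_mul (hlimα.add hlim1)
      (Or.inr hC)) (Or.inr hctop)
  refine tendsto_of_tendsto_of_tendsto_of_le_of_le tendsto_const_nhds hlim
    (fun _ => zero_le) fun n => ?_
  -- Both integrals are stable integrals of fractional integrals, so the estimate reduces to
  -- $\|I_-^d(g_n-g)\|_\alpha$.
  refine ((hspec n).2.eLpNorm_sub_le hL hα1.le hp1.le hpα hspec₀.2).trans ?_
  rw [← eLpNorm_congr_ae
    (StableLFSM.rlRight_sub_ae hα1 hd0 hd1 (hg1 n) (hgα n) hg₀1 hg₀α)]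
  exact mul_le_mul_right (hle _ ((hg1 n).1.sub hg₀1.1)) _
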